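/- Let $k$ be a field, $R=k[x_1,\dots,x_n]$ with the standard grading, and for $S\subseteq\{1,\dots,n\}$ let $\mathfrak m_S=(x_s : s\in S)\subseteq R$. Let $J,K\subseteq\{1,\dots,n\}$ be such that $A=J\setminus K$, $B=K\setminus J$ and $C=J\cap K$ are all nonempty, and let $a\ge b\ge 1$ be integers. Put $$V=\sum_{t=1}^{b}\mathfrak m_B^{t}\,\mathfrak m_A^{a-b+t}\,\mathfrak m_C^{b-t}=\mathfrak m_B\mathfrak m_A^{a-b+1}\mathfrak m_C^{b-1}+\mathfrak m_B^2\mathfrak m_A^{a-b+2}\mathfrak m_C^{b-2}+\cdots+\mathfrak m_B^{b}\mathfrak m_A^{a}.$$ Let $\beta_{i,j}(V)$ denote the graded Betti numbers of $V$, i.e. the number of summands $R(-j)$ in homological degree $i$ of a minimal graded free resolution $\cdots\to F_1\to F_0\to V\to 0$ of $V$ over $R$. Then for all $i\ge 0$ $$\beta_{i,i+a+1}(V)=\sum_{\substack{i_1,i_2,i_3\ge 0\\ i_1+i_2+i_3=i}}\binom{|B|}{1+i_1}\binom{|A|+a-b}{a-b+1+i_2}\binom{a-b+i_2}{i_2}\binom{|C|+b-2}{b-1+i_3}\binom{b+i_3-2}{i_3},$$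 and for all $i\ge 0$ and all $j$ with $2\le j\le b$ $$\beta_{i,i+a+j}(V)=\sum_{k_1=0}^{|A|-1}\sum_{k_2=0}^{|B|-1}\binom{|C|+b-j-1}{b-j}\binom{k_1+a-b+j-1}{a-b+j-1}\binom{k_2+j-1}{j-1}\binom{|C|+k_1+k_2}{i}.$$ Here $\binom{-1}{0}=1$ (this occurs only for $b=1$, $i_3=0$ in the last factor of the first formula). -/

import Mathlib

open MvPolynomial

/-- The monomial prime ideal `𝔪_J = (x_j : j ∈ J)` of `k[x_1, …, x_n]`. -/
noncomputable def varIdeal (k : Type*) [Field k] {n : ℕ} (J : Finset (Fin n)) :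
    Ideal (MvPolynomial (Fin n) k) :=
  Ideal.span ((fun j => (X j : MvPolynomial (Fin n) k)) '' (J : Set (Fin n)))

/-- A vector `v` is homogeneous of degree `e` in the graded free module
`R(-s_1) ⊕ ⋯ ⊕ R(-s_r)` over `R = k[x_1, …, x_n]`: its `p`-th coordinate is a form of degree
`e - s_p` (and is `0` when `e < s_p`). -/
def IsHomogeneousVec {k : Type*} [Field k] {n r : ℕ} (s : Fin r → ℕ) (e : ℕ)
    (v : Fin r → MvPolynomial (Fin n) k) : Prop :=
  ∀ p, v p = 0 ∨ ∃ m, s p + m = e ∧ (v p).IsHomogeneous m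

/-- A graded free resolution of finite length, by finitely generated graded free modules,
`0 → F_h → ⋯ → F_1 → F_0 → I → 0` of an ideal `I` of `R = k[x_1, …, x_n]`, where
`F_i = ⊕_p R(-shift i p)`, with `p` running through `Fin (rank i)`. -/
structure GradedFreeResolution {k : Type*} [Field k] {n : ℕ}
    (I : Ideal (MvPolynomial (Fin n) k)) where
  /-- The number of summands of `F_i`. -/
  rank : ℕ → ℕ
  /-- The degrees of the standard basis elements of `F_i`. -/
  shift : ∀ i, Fin (rank i) → ℕ
  /-- The differential `F_{i+1} → F_i`. -/
  d : ∀ i, (Fin (rank (i + 1)) → MvPolynomial (Fin n) k) →ₗ[MvPolynomial (Fin n) k]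
    (Fin (rank i) → MvPolynomial (Fin n) k)
  /-- The augmentation `F_0 → I ⊆ R`. -/
  aug : (Fin (rank 0) → MvPolynomial (Fin n) k) →ₗ[MvPolynomial (Fin n) k]
    MvPolynomial (Fin n) k
  /-- The differentials are homogeneous of degree `0` (tested on the basis). -/
  d_homogeneous : ∀ i q, IsHomogeneousVec (shift i) (shift (i + 1) q) (d i (Pi.single q 1))
  /-- The augmentation is homogeneous of degree `0` (tested on the basis). -/
  aug_homogeneous : ∀ q, (aug (Pi.single q 1)).IsHomogeneous (shift 0 q)
  /-- Exactness at `I`. -/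
  range_aug : LinearMap.range aug = I
  /-- Exactness at `F_0`. -/
  exact_zero : LinearMap.range (d 0) = LinearMap.ker aug
  /-- Exactness at `F_{i+1}`. -/
  exact_succ : ∀ i, LinearMap.range (d (i + 1)) = LinearMap.ker (d i)
  /-- Finite length. -/
  finite_length : ∃ h, ∀ i, h < i → rank i = 0

namespace GradedFreeResolution

variable {k : Type*} [Field k] {n : ℕ} {I : Ideal (MvPolynomial (Fin n) k)}

/-- A graded free resolution is minimal if every differential maps `F_{i+1}` into `𝔪 F_i`,
with `𝔪 = (x_1, …, x_n)`. -/
def IsMinimal (F : GradedFreeResolution I) : Prop :=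
  ∀ i, LinearMap.range (F.d i) ≤
    varIdeal k (Finset.univ : Finset (Fin n)) •
      (⊤ : Submodule (MvPolynomial (Fin n) k) (Fin (F.rank i) → MvPolynomial (Fin n) k))

/-- The number of summands `R(-j)` of `F_i`. -/
def betti (F : GradedFreeResolution I) (i j : ℕ) : ℕ :=
  (Finset.univ.filter fun p : Fin (F.rank i) => F.shift i p = j).card

end GradedFreeResolution

/-- `β_{i,j}(I) = N`: the ideal `I` has a minimal graded free resolution, and in every
such resolution the summand `R(-j)` occurs exactly `N` times in homological degree `i`. -/
def HasGradedBetti {k : Type*} [Field k] {n : ℕ} (I : Ideal (MvPolynomial (Fin n) k))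
    (i j N : ℕ) : Prop :=
  (∃ F : GradedFreeResolution I, F.IsMinimal) ∧
    ∀ F : GradedFreeResolution I, F.IsMinimal → F.betti i j = N

/-- The ideal `V = 𝔪_B 𝔪_A^{a-b+1} 𝔪_C^{b-1} + 𝔪_B² 𝔪_A^{a-b+2} 𝔪_C^{b-2} + ⋯ + 𝔪_B^b 𝔪_A^a`
with `A = J \ K`, `B = K \ J`, `C = J ∩ K` (used for `b ≤ a`). -/
noncomputable def idealV (k : Type*) [Field k] {n : ℕ} (J K : Finset (Fin n)) (a b : ℕ) :
    Ideal (MvPolynomial (Fin n) k) :=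
  ∑ t ∈ Finset.Icc 1 b,
    varIdeal k (K \ J) ^ t * varIdeal k (J \ K) ^ (a - b + t) * varIdeal k (J ∩ K) ^ (b - t)

/-! The ideal V has linear quotients. Put c = a - b. Its generators are the monomials of degree c +
t in the variables of A, t in those of B and b - t in those of C, for 1 ≤ t ≤ b, so their total
degree is a + t. List them by degree, then lexicographically. The colon ideal of the predecessors of
u by u is generated by variables: in each of the blocks A, B, C, those after the first variable of
the block that divides u, and the whole of C as soon as t ≥ 2, because x_l u / (x_i x_i') with l in
C, i in A, i' in B is then a generator of level t - 1 (`exists_of_mem_colonVars`,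
`exists_mem_colonVars_lt`).

Adjoining a generator of degree e whose colon ideal L is generated by m variables adds a quotient
isomorphic to (R/L)(-e), resolved by a shifted Koszul complex. The horseshoe lemma splices it onto
the resolution already built. The result stays minimal because the degrees never decrease along the
list: the old shifts in homological degree i are at most e + i, while the new ones in degree i + 1
equal e + i + 1. Hence β_{i,i+e} is the sum of binom(m, i) over the generators of degree e
(`hasMinimalResolution_of_linearQuotients`). Any other minimal resolution has the same Betti
numbers, by comparison of resolutions modulo the variables (`IsMinimal.betti_le`).

The rest is counting. Among the monomials of degree e + 1 in the variables of T, exactly binom(m +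
e, e) have m variables of T after their first one, for each m < |T| (`sum_laterVars`). For j ≥ 2 the
block C enters only through its number of monomials, which gives the second formula; for j = 1
Vandermonde's identity separates the three blocks. -/

/-! ### Graded free modules, homogeneous maps and their lifts -/

section GradedFree

variable {k : Type*} [Field k] {n : ℕ} {ι κ τ : Type*}

/-- The component of degree `e` of a vector in the graded free module `⨁ R(-s p)`. -/
noncomputable def gradedPart (s : ι → ℕ) (e : ℕ) :
    (ι → MvPolynomial (Fin n) k) →ₗ[k] (ι → MvPolynomial (Fin n) k) :=
  LinearMap.pi fun p =>
    if s p ≤ e then homogeneousComponent (e - s p) ∘ₗ LinearMap.proj p else 0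

theorem gradedPart_apply (s : ι → ℕ) (e : ℕ) (v : ι → MvPolynomial (Fin n) k) (p : ι) :
    gradedPart s e v p = if s p ≤ e then homogeneousComponent (e - s p) (v p) else 0 := by
  simp only [gradedPart, LinearMap.pi_apply]
  split_ifs <;> simp

/-- Homogeneous vectors of degree `e` in the graded free module `⨁ R(-s p)`. -/
def IsHomVec (s : ι → ℕ) (e : ℕ) (v : ι → MvPolynomial (Fin n) k) : Prop :=
  gradedPart s e v = v

theorem isHomVec_iff {s : ι → ℕ} {e : ℕ} {v : ι → MvPolynomial (Fin n) k} :
    IsHomVec s e v ↔ ∀ p, v p = 0 ∨ ∃ m, s p + m = e ∧ (v p).IsHomogeneous m := by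
  constructor
  · intro h p
    have hp := congrFun h p
    rw [gradedPart_apply] at hp
    split_ifs at hp with hs
    · refine Or.inr ⟨e - s p, by omega, ?_⟩
      rw [← hp]
      exact homogeneousComponent_isHomogeneous _ _
    · exact Or.inl hp.symm
  · intro h
    funext p
    rw [gradedPart_apply]
    rcases h p with h0 | ⟨m, hm, hv⟩
    · simp [h0]
    · rw [if_pos (by omega), show e - s p = m by omega, homogeneousComponent_eq_self hv]

theorem isHomogeneousVec_iff {r : ℕ} {s : Fin r → ℕ} {e : ℕ}
    {v : Fin r → MvPolynomial (Fin n) k} : IsHomogeneousVec s e v ↔ IsHomVec s e v :=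
  isHomVec_iff.symm

theorem isHomVec_gradedPart (s : ι → ℕ) (e : ℕ) (v : ι → MvPolynomial (Fin n) k) :
    IsHomVec s e (gradedPart s e v) := by
  rw [isHomVec_iff]
  intro p
  rw [gradedPart_apply]
  split_ifs with hs
  · exact Or.inr ⟨e - s p, by omega, homogeneousComponent_isHomogeneous _ _⟩
  · exact Or.inl rfl

theorem IsHomVec.neg {s : ι → ℕ} {e : ℕ} {v : ι → MvPolynomial (Fin n) k}
    (h : IsHomVec s e v) : IsHomVec s e (-v) := by
  unfold IsHomVec at *
  rw [map_neg, h]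

theorem isHomVec_zero (s : ι → ℕ) (e : ℕ) :
    IsHomVec s e (0 : ι → MvPolynomial (Fin n) k) := map_zero _

theorem IsHomVec.constantCoeff_apply_eq_zero {s : ι → ℕ} {e : ℕ} {v : ι → MvPolynomial (Fin n) k}
    (h : IsHomVec s e v) {p : ι} (hp : s p ≠ e) : constantCoeff (v p) = 0 := by
  rcases isHomVec_iff.1 h p with h0 | ⟨m, hm, hv⟩
  · simp [h0]
  · exact hv.coeff_eq_zero (by simp; omega)

attribute [local instance] MvPolynomial.gradedAlgebra in
theorem homogeneousComponent_mul_of_isHomogeneous {m : ℕ} (N : ℕ) (r : MvPolynomial (Fin n) k)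
    {v : MvPolynomial (Fin n) k} (hv : v.IsHomogeneous m) :
    homogeneousComponent N (r * v) =
      (if m ≤ N then homogeneousComponent (N - m) r else 0) * v := by
  have h := DirectSum.coe_decompose_mul_of_right_mem (homogeneousSubmodule (Fin n) k) (a := r) N
    ((mem_homogeneousSubmodule m v).2 hv)
  have key : ∀ (φ : MvPolynomial (Fin n) k) (i : ℕ),
    ((DirectSum.decompose (homogeneousSubmodule (Fin n) k) φ) i : MvPolynomial (Fin n) k) =
      homogeneousComponent i φ := fun φ i => decomposition.decompose'_apply φ i
  rw [key] at h
  rw [h]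
  split_ifs
  · rw [key]
  · simp

theorem IsHomVec.gradedPart_smul {s : ι → ℕ} {e' : ℕ} {v : ι → MvPolynomial (Fin n) k}
    (h : IsHomVec s e' v) (e : ℕ) (r : MvPolynomial (Fin n) k) :
    gradedPart s e (r • v) = (if e' ≤ e then homogeneousComponent (e - e') r else 0) • v := by
  funext p
  rw [gradedPart_apply]
  simp only [Pi.smul_apply, smul_eq_mul]
  rcases isHomVec_iff.1 h p with h0 | ⟨m, hm, hv⟩
  · simp [h0]
  · rw [homogeneousComponent_mul_of_isHomogeneous _ _ hv]
    by_cases he : e' ≤ e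
    · rw [if_pos (by omega), if_pos (by omega), if_pos he, show e - s p - m = e - e' by omega]
    · rw [if_neg he]
      split_ifs
      · omega
      · rfl
      · simp

/-- A linear map between graded free modules is homogeneous of degree zero. -/
def IsHomMap [DecidableEq κ] (s : ι → ℕ) (t : κ → ℕ)
    (d : (κ → MvPolynomial (Fin n) k) →ₗ[MvPolynomial (Fin n) k] (ι → MvPolynomial (Fin n) k)) :
    Prop :=
  ∀ q, IsHomVec s (t q) (d (Pi.single q 1))

theorem LinearMap.pi_apply_eq_sum_smul_single {R M : Type*} [CommSemiring R] [AddCommMonoid M]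
    [Module R M] [Fintype κ] [DecidableEq κ] (d : (κ → R) →ₗ[R] M) (v : κ → R) :
    d v = ∑ q, v q • d (Pi.single q 1) := by
  conv_lhs => rw [pi_eq_sum_univ' v]
  rw [map_sum]
  refine Finset.sum_congr rfl fun q _ => ?_
  rw [map_smul]

variable [Fintype κ] [DecidableEq κ] [Fintype τ] [DecidableEq τ]

theorem IsHomMap.gradedPart_apply {s : ι → ℕ} {t : κ → ℕ}
    {d : (κ → MvPolynomial (Fin n) k) →ₗ[MvPolynomial (Fin n) k] (ι → MvPolynomial (Fin n) k)}
    (hd : IsHomMap s t d) (e : ℕ) (v : κ → MvPolynomial (Fin n) k) :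
    gradedPart s e (d v) = d (gradedPart t e v) := by
  rw [LinearMap.pi_apply_eq_sum_smul_single d v,
    LinearMap.pi_apply_eq_sum_smul_single d (gradedPart t e v), map_sum]
  refine Finset.sum_congr rfl fun q _ => ?_
  rw [(hd q).gradedPart_smul, _root_.gradedPart_apply]

theorem IsHomMap.apply {s : ι → ℕ} {t : κ → ℕ}
    {d : (κ → MvPolynomial (Fin n) k) →ₗ[MvPolynomial (Fin n) k] (ι → MvPolynomial (Fin n) k)}
    (hd : IsHomMap s t d) {e : ℕ} {v : κ → MvPolynomial (Fin n) k} (hv : IsHomVec t e v) :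
    IsHomVec s e (d v) := by
  unfold IsHomVec
  rw [hd.gradedPart_apply, hv]

/-- A homogeneous map commutes with taking graded parts, so the degree `e` part of any preimage is
again a preimage. -/
theorem IsHomMap.exists_lift_vec {s : ι → ℕ} {t : κ → ℕ}
    {d : (κ → MvPolynomial (Fin n) k) →ₗ[MvPolynomial (Fin n) k] (ι → MvPolynomial (Fin n) k)}
    (hd : IsHomMap s t d) {e : ℕ} {w : ι → MvPolynomial (Fin n) k} (hw : IsHomVec s e w)
    (hr : w ∈ LinearMap.range d) : ∃ v, IsHomVec t e v ∧ d v = w := by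
  obtain ⟨v, rfl⟩ := hr
  exact ⟨gradedPart t e v, isHomVec_gradedPart _ _ _, by rw [← hd.gradedPart_apply, hw]⟩

/-- Projectivity of a free module. The predicate `P` lets one statement serve both for homogeneous
lifts and for plain ones. -/
theorem LinearMap.exists_comp_eq_of_range_le {R M N : Type*} [CommSemiring R] [AddCommMonoid M]
    [Module R M] [AddCommMonoid N] [Module R N] (P : κ → M → Prop) (d : M →ₗ[R] N)
    (θ : (κ → R) →ₗ[R] N)
    (h : ∀ q, ∃ v, P q v ∧ d v = θ (Pi.single q 1)) :
    ∃ ψ : (κ → R) →ₗ[R] M, (∀ q, P q (ψ (Pi.single q 1))) ∧ d ∘ₗ ψ = θ := by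
  choose f hP hf using h
  refine ⟨Fintype.linearCombination R f, fun q => ?_, ?_⟩
  · rw [Fintype.linearCombination_apply_single, one_smul]
    exact hP q
  · refine LinearMap.pi_ext' fun q => LinearMap.ext_ring ?_
    simp [Fintype.linearCombination_apply_single, hf]

theorem IsHomMap.exists_lift {s : ι → ℕ} {t : κ → ℕ} {u : τ → ℕ}
    {d : (κ → MvPolynomial (Fin n) k) →ₗ[MvPolynomial (Fin n) k] (ι → MvPolynomial (Fin n) k)}
    (hd : IsHomMap s t d)
    {θ : (τ → MvPolynomial (Fin n) k) →ₗ[MvPolynomial (Fin n) k] (ι → MvPolynomial (Fin n) k)}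
    (hθ : IsHomMap s u θ) (hr : ∀ x, θ x ∈ LinearMap.range d) :
    ∃ ψ : (τ → MvPolynomial (Fin n) k) →ₗ[MvPolynomial (Fin n) k] (κ → MvPolynomial (Fin n) k),
      IsHomMap t u ψ ∧ d ∘ₗ ψ = θ :=
  LinearMap.exists_comp_eq_of_range_le (fun q v => IsHomVec t (u q) v) d θ
    fun q => hd.exists_lift_vec (hθ q) (hr _)

theorem LinearMap.exists_lift_pi {R M N : Type*} [CommSemiring R] [AddCommMonoid M]
    [Module R M] [AddCommMonoid N] [Module R N] (d : M →ₗ[R] N)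
    (θ : (κ → R) →ₗ[R] N) (hr : ∀ x, θ x ∈ LinearMap.range d) :
    ∃ ψ : (κ → R) →ₗ[R] M, d ∘ₗ ψ = θ := by
  obtain ⟨ψ, -, h⟩ := LinearMap.exists_comp_eq_of_range_le (fun _ _ => True) d θ
    fun q => by obtain ⟨v, hv⟩ := hr (Pi.single q 1); exact ⟨v, trivial, hv⟩
  exact ⟨ψ, h⟩

omit [Fintype κ] in
/-- A functional on a graded free module, viewed as a map to the free module of rank one, is
homogeneous exactly when it sends basis vectors to forms of the right degrees. -/
theorem isHomMap_pi_iff {t : κ → ℕ}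
    {f : (κ → MvPolynomial (Fin n) k) →ₗ[MvPolynomial (Fin n) k] MvPolynomial (Fin n) k} :
    IsHomMap (fun _ : Unit => 0) t (LinearMap.pi fun _ => f) ↔
      ∀ q, (f (Pi.single q 1)).IsHomogeneous (t q) := by
  refine forall_congr' fun q => ?_
  rw [isHomVec_iff]
  constructor
  · intro h
    rcases h () with h0 | ⟨m, hm, h⟩
    · simp only [LinearMap.pi_apply] at h0
      rw [h0]
      exact isHomogeneous_zero _ _ _
    · simp only [zero_add] at hm
      subst hm
      simpa using h
  · intro h _
    exact Or.inr ⟨t q, zero_add _, by simpa using h⟩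

theorem exists_lift_functional {t : κ → ℕ} {u : τ → ℕ}
    {f : (κ → MvPolynomial (Fin n) k) →ₗ[MvPolynomial (Fin n) k] MvPolynomial (Fin n) k}
    (hf : ∀ q, (f (Pi.single q 1)).IsHomogeneous (t q))
    {g : (τ → MvPolynomial (Fin n) k) →ₗ[MvPolynomial (Fin n) k] MvPolynomial (Fin n) k}
    (hg : ∀ q, (g (Pi.single q 1)).IsHomogeneous (u q)) (hr : ∀ x, g x ∈ LinearMap.range f) :
    ∃ ψ : (τ → MvPolynomial (Fin n) k) →ₗ[MvPolynomial (Fin n) k] (κ → MvPolynomial (Fin n) k),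
      IsHomMap t u ψ ∧ f ∘ₗ ψ = g := by
  obtain ⟨ψ, h1, h2⟩ := (isHomMap_pi_iff.2 hf).exists_lift (isHomMap_pi_iff.2 hg) (fun x => by
    obtain ⟨v, hv⟩ := hr x
    exact ⟨v, by funext _; simpa using hv⟩)
  refine ⟨ψ, h1, LinearMap.ext fun x => ?_⟩
  simpa using congrFun (LinearMap.congr_fun h2 x) ()

/-- Dependent choice with an invariant `P` and a relation `Q` between neighbours; chain maps,
homotopies and connecting maps are all built this way. -/
theorem exists_dependent_seq {α : ℕ → Type*} (P : ∀ i, α i → Prop)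
    (Q : ∀ i, α i → α (i + 1) → Prop) (h0 : ∃ a, P 0 a)
    (hs : ∀ i a, P i a → ∃ b, P (i + 1) b ∧ Q i a b) :
    ∃ f : ∀ i, α i, ∀ i, P i (f i) ∧ Q i (f i) (f (i + 1)) := by
  choose g hg using hs
  let F : ∀ i, {a : α i // P i a} := fun i =>
    Nat.rec ⟨h0.choose, h0.choose_spec⟩ (fun i a => ⟨g i a.1 a.2, (hg i a.1 a.2).1⟩) i
  exact ⟨fun i => (F i).1, fun i => ⟨(F i).2, (hg i (F i).1 (F i).2).2⟩⟩

theorem constantCoeff_eq_zero_of_mem_varIdeal {J : Finset (Fin n)} {r : MvPolynomial (Fin n) k}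
    (h : r ∈ varIdeal k J) : constantCoeff r = 0 := by
  have : varIdeal k J ≤ RingHom.ker (constantCoeff (R := k) (σ := Fin n)) := by
    rw [varIdeal, Ideal.span_le]
    rintro _ ⟨j, -, rfl⟩
    simp
  exact this h

theorem mem_varIdeal_iff {J : Finset (Fin n)} {r : MvPolynomial (Fin n) k} :
    r ∈ varIdeal k J ↔ ∀ m ∈ r.support, ∃ j ∈ J, m j ≠ 0 := by
  rw [varIdeal, mem_ideal_span_X_image]
  simp

theorem mem_varIdeal_univ_iff {r : MvPolynomial (Fin n) k} :
    r ∈ varIdeal k (Finset.univ : Finset (Fin n)) ↔ constantCoeff r = 0 := by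
  refine ⟨constantCoeff_eq_zero_of_mem_varIdeal, fun h => mem_varIdeal_iff.2 fun m hm => ?_⟩
  by_contra! hc
  have : m = 0 := Finsupp.ext fun j => by simpa using hc j (Finset.mem_univ j)
  subst this
  exact (mem_support_iff.1 hm) h

theorem mem_varIdeal_univ_smul_top_iff {v : κ → MvPolynomial (Fin n) k} :
    v ∈ varIdeal k (Finset.univ : Finset (Fin n)) •
      (⊤ : Submodule (MvPolynomial (Fin n) k) (κ → MvPolynomial (Fin n) k)) ↔
      ∀ p, constantCoeff (v p) = 0 := by
  constructor
  · intro h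
    refine Submodule.smul_induction_on h (fun r hr w _ p => ?_) (fun x y hx hy p => ?_)
    · simp [mem_varIdeal_univ_iff.1 hr]
    · simp [hx p, hy p]
  · intro h
    have := LinearMap.pi_apply_eq_sum_smul_single
      (LinearMap.id (R := MvPolynomial (Fin n) k) (M := κ → MvPolynomial (Fin n) k)) v
    rw [LinearMap.id_apply] at this
    rw [this]
    exact Submodule.sum_mem _ fun q _ =>
      Submodule.smul_mem_smul (mem_varIdeal_univ_iff.2 (h q)) Submodule.mem_top

theorem constantCoeff_linearMap_apply
    (d : (κ → MvPolynomial (Fin n) k) →ₗ[MvPolynomial (Fin n) k] (ι → MvPolynomial (Fin n) k))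
    (v : κ → MvPolynomial (Fin n) k) (p : ι) : constantCoeff (d v p) =
      ∑ q, constantCoeff (v q) * constantCoeff (d (Pi.single q 1) p) := by
  rw [LinearMap.pi_apply_eq_sum_smul_single d v]
  simp

end GradedFree

/-! ### Uniqueness of the graded Betti numbers -/

namespace GradedFreeResolution

variable {k : Type*} [Field k] {n : ℕ} {I : Ideal (MvPolynomial (Fin n) k)}

theorem aug_d (F : GradedFreeResolution I) (x) : F.aug (F.d 0 x) = 0 :=
  (F.exact_zero.le ⟨x, rfl⟩ : F.d 0 x ∈ LinearMap.ker F.aug)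

theorem d_d (F : GradedFreeResolution I) (i) (x) : F.d i (F.d (i + 1) x) = 0 :=
  ((F.exact_succ i).le ⟨x, rfl⟩ : F.d (i + 1) x ∈ LinearMap.ker (F.d i))

theorem isHomMap_d (F : GradedFreeResolution I) (i : ℕ) :
    IsHomMap (F.shift i) (F.shift (i + 1)) (F.d i) :=
  fun q => isHomogeneousVec_iff.1 (F.d_homogeneous i q)

/-- Comparison theorem: the identity of `I` lifts to a homogeneous chain map. -/
theorem exists_chainMap (F G : GradedFreeResolution I) :
    ∃ f : ∀ i, (Fin (F.rank i) → MvPolynomial (Fin n) k) →ₗ[MvPolynomial (Fin n) k]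
        (Fin (G.rank i) → MvPolynomial (Fin n) k),
      (∀ i, IsHomMap (G.shift i) (F.shift i) (f i)) ∧ G.aug ∘ₗ f 0 = F.aug ∧
        ∀ i, G.d i ∘ₗ f (i + 1) = f i ∘ₗ F.d i := by
  refine Exists.elim (exists_dependent_seq
    (α := fun i => (Fin (F.rank i) → MvPolynomial (Fin n) k) →ₗ[MvPolynomial (Fin n) k]
        (Fin (G.rank i) → MvPolynomial (Fin n) k))
    (P := fun i f => IsHomMap (G.shift i) (F.shift i) f ∧
      -- This clause is exactly what the next lift needs. Compatibility with the augmentations makes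
      -- sense only at index 0, so it is guarded by an equation and transported along it.
      (∀ x, f (F.d i x) ∈ LinearMap.range (G.d i)) ∧
      ∀ h : i = 0, G.aug ∘ₗ (h ▸ LinearMap.id) ∘ₗ f = F.aug ∘ₗ (h ▸ LinearMap.id))
    (Q := fun i f f' => G.d i ∘ₗ f' = f ∘ₗ F.d i) ?_ ?_)
    fun f hf => ⟨f, fun i => (hf i).1.1, (hf 0).1.2.2 rfl, fun i => (hf i).2⟩
  · obtain ⟨f, h1, h2⟩ := exists_lift_functional G.aug_homogeneous F.aug_homogeneous
      (fun x => by rw [G.range_aug]; exact F.range_aug.le ⟨x, rfl⟩)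
    refine ⟨f, h1, fun x => ?_, fun _ => h2⟩
    rw [G.exact_zero, LinearMap.mem_ker]
    have := LinearMap.congr_fun h2 (F.d 0 x)
    rw [F.aug_d] at this
    exact this
  · rintro i f ⟨h1, h2, -⟩
    obtain ⟨f', h3, h4⟩ := (G.isHomMap_d i).exists_lift (u := F.shift (i + 1)) (θ := f ∘ₗ F.d i)
      (fun q => h1.apply (F.isHomMap_d i q)) h2
    refine ⟨f', ⟨h3, fun x => ?_, fun h => by omega⟩, h4⟩
    rw [G.exact_succ, LinearMap.mem_ker]
    have := LinearMap.congr_fun h4 (F.d (i + 1) x)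
    simpa [F.d_d] using this

/-- A self-map of a resolution that lifts the identity of `I` is homotopic to the identity. -/
theorem exists_homotopy (F : GradedFreeResolution I)
    (f : ∀ i, (Fin (F.rank i) → MvPolynomial (Fin n) k) →ₗ[MvPolynomial (Fin n) k]
        (Fin (F.rank i) → MvPolynomial (Fin n) k))
    (h0 : ∀ x, F.aug (f 0 x) = F.aug x) (hd : ∀ i x, F.d i (f (i + 1) x) = f i (F.d i x)) :
    ∃ h : ∀ i, (Fin (F.rank i) → MvPolynomial (Fin n) k) →ₗ[MvPolynomial (Fin n) k]
        (Fin (F.rank (i + 1)) → MvPolynomial (Fin n) k),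
      (∀ x, F.d 0 (h 0 x) = f 0 x - x) ∧
        ∀ i x, F.d (i + 1) (h (i + 1) x) = f (i + 1) x - x - h i (F.d i x) := by
  refine Exists.elim (exists_dependent_seq
    (α := fun i => (Fin (F.rank i) → MvPolynomial (Fin n) k) →ₗ[MvPolynomial (Fin n) k]
        (Fin (F.rank (i + 1)) → MvPolynomial (Fin n) k))
    (P := fun i h => (∀ x, F.d i (h (F.d i x)) = f i (F.d i x) - F.d i x) ∧
      ∀ h0 : i = 0, ∀ x, F.d i (h x) = f i x - x)
    (Q := fun i h h' => ∀ x, F.d (i + 1) (h' x) = f (i + 1) x - x - h (F.d i x)) ?_ ?_)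
    fun h hh => ⟨h, (hh 0).1.2 rfl, fun i => (hh i).2⟩
  · obtain ⟨h, hh⟩ := LinearMap.exists_lift_pi (F.d 0) (f 0 - LinearMap.id) (fun x => by
      rw [F.exact_zero, LinearMap.mem_ker]
      simp [h0])
    have hh' : ∀ x, F.d 0 (h x) = f 0 x - x := fun x => LinearMap.congr_fun hh x
    exact ⟨h, fun x => hh' _, fun _ => hh'⟩
  · rintro i h ⟨h1, -⟩
    obtain ⟨h', hh⟩ := LinearMap.exists_lift_pi (F.d (i + 1))
      (f (i + 1) - LinearMap.id - h ∘ₗ F.d i) (fun x => by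
      rw [F.exact_succ, LinearMap.mem_ker]
      simp [h1, hd])
    have hh' : ∀ x, F.d (i + 1) (h' x) = f (i + 1) x - x - h (F.d i x) :=
      fun x => LinearMap.congr_fun hh x
    exact ⟨h', ⟨fun x => by rw [hh', F.d_d]; simp, fun h => by omega⟩, hh'⟩

theorem IsMinimal.constantCoeff_d {F : GradedFreeResolution I} (hF : F.IsMinimal) (i : ℕ) (x p) :
    constantCoeff (F.d i x p) = 0 :=
  mem_varIdeal_univ_smul_top_iff.1 (hF i ⟨x, rfl⟩) p

/-- Compose chain maps F → G → F. The composite is homotopic to the identity, and since F is minimal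
it equals the identity modulo the variables. In each degree `j` the constant terms of F → G
therefore form an injective matrix over `k`. Only F has to be minimal. -/
theorem IsMinimal.betti_le {F : GradedFreeResolution I} (hF : F.IsMinimal)
    (G : GradedFreeResolution I) (i j : ℕ) : F.betti i j ≤ G.betti i j := by
  obtain ⟨f, hf, hf0, hfd⟩ := F.exists_chainMap G
  obtain ⟨g, -, hg0, hgd⟩ := G.exists_chainMap F
  obtain ⟨h, hh0, hh⟩ := F.exists_homotopy (fun i => g i ∘ₗ f i)
    (fun x => (LinearMap.congr_fun hg0 (f 0 x)).trans (LinearMap.congr_fun hf0 x))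
    (fun i x => (LinearMap.congr_fun (hgd i) _).trans
      (congrArg (g i) (LinearMap.congr_fun (hfd i) x)))
  have hgf : ∀ i x p, constantCoeff (g i (f i x) p) = constantCoeff (x p) := by
    rintro (_ | i) x p
    · have h1 := congrFun (hh0 x) p
      have h2 := hF.constantCoeff_d 0 (h 0 x) p
      rw [h1] at h2
      simpa [sub_eq_zero] using h2
    · have h1 := congrFun (hh i x) p
      have h2 := hF.constantCoeff_d (i + 1) (h (i + 1) x) p
      rw [h1] at h2
      have h3 : constantCoeff (h i (F.d i x) p) = 0 := by
        rw [constantCoeff_linearMap_apply]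
        exact Finset.sum_eq_zero fun q _ => by rw [hF.constantCoeff_d, zero_mul]
      simpa [h3, sub_eq_zero] using h2
  let M : Matrix {p // G.shift i p = j} {q // F.shift i q = j} k :=
    fun p q => constantCoeff (f i (Pi.single q.1 1) p.1)
  let N : Matrix {q // F.shift i q = j} {p // G.shift i p = j} k :=
    fun q p => constantCoeff (g i (Pi.single p.1 1) q.1)
  have hNM : N * M = 1 := by
    ext q q'
    have h1 := hgf i (Pi.single q'.1 1) q.1
    rw [constantCoeff_linearMap_apply] at h1
    rw [Matrix.mul_apply, Matrix.one_apply]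
    have h2 : constantCoeff ((Pi.single q'.1 1 : Fin (F.rank i) → MvPolynomial (Fin n) k) q.1) =
        if q = q' then (1 : k) else 0 := by
      rw [Pi.single_apply]
      simp [Subtype.ext_iff, apply_ite]
    rw [← h2, ← h1, ← Finset.sum_filter_of_ne (p := fun p => G.shift i p = j),
      Finset.sum_subtype (p := fun p => G.shift i p = j) _ (by simp)]
    · exact Finset.sum_congr rfl fun p _ => mul_comm _ _
    -- A homogeneous map has no constant entries between basis elements of different degrees, so the
    -- sum restricts to those of degree `j`.
    · intro p _ hp
      by_contra hc
      exact hp (by rw [(hf i q'.1).constantCoeff_apply_eq_zero (by rw [q'.2]; exact hc), zero_mul])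
  have hinj : Function.Injective M.mulVecLin := by
    intro x y hxy
    have := congrArg N.mulVec hxy
    simpa [hNM] using this
  have hle := LinearMap.finrank_le_finrank_of_injective hinj
  simpa [betti, Fintype.card_subtype] using hle

theorem hasGradedBetti (F : GradedFreeResolution I) (hF : F.IsMinimal) (i j : ℕ) :
    HasGradedBetti I i j (F.betti i j) :=
  ⟨⟨F, hF⟩, fun G hG => le_antisymm (hG.betti_le F i j) (hF.betti_le G i j)⟩

end GradedFreeResolution

/-! ### Resolutions of subquotients: quotient, twist and horseshoe -/

/-- A bounded augmented complex of graded free modules, exact in positive homological degrees,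
with bases indexed by arbitrary finite types. -/
structure GradedFreeComplex (k : Type*) [Field k] (n : ℕ) where
  /-- The basis of the `i`-th free module. -/
  ι : ℕ → Type
  [fintype : ∀ i, Fintype (ι i)]
  [decEq : ∀ i, DecidableEq (ι i)]
  /-- The degrees of the basis elements. -/
  shift : ∀ i, ι i → ℕ
  /-- The differential. -/
  d : ∀ i, (ι (i + 1) → MvPolynomial (Fin n) k) →ₗ[MvPolynomial (Fin n) k]
    (ι i → MvPolynomial (Fin n) k)
  /-- The augmentation. -/
  aug : (ι 0 → MvPolynomial (Fin n) k) →ₗ[MvPolynomial (Fin n) k] MvPolynomial (Fin n) k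
  isHomMap_d : ∀ i, IsHomMap (shift i) (shift (i + 1)) (d i)
  aug_homogeneous : ∀ q, (aug (Pi.single q 1)).IsHomogeneous (shift 0 q)
  exact_succ : ∀ i x, d i x = 0 ↔ ∃ y, d (i + 1) y = x
  finite_length : ∃ h, ∀ i, h < i → IsEmpty (ι i)

namespace GradedFreeComplex

attribute [instance] GradedFreeComplex.fintype GradedFreeComplex.decEq

variable {k : Type*} [Field k] {n : ℕ}

/-- The complex is a resolution of the subquotient `M / N` of the polynomial ring. -/
def Resolves (F : GradedFreeComplex k n) (N M : Ideal (MvPolynomial (Fin n) k)) : Prop :=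
  LinearMap.range F.aug ⊔ N = M ∧ ∀ x, F.aug x ∈ N ↔ ∃ y, F.d 0 y = x

/-- All differentials vanish modulo the variables. -/
def Minimal (F : GradedFreeComplex k n) : Prop :=
  ∀ i x p, constantCoeff (F.d i x p) = 0

/-- The number of basis elements of degree `j` in homological degree `i`. -/
def betti (F : GradedFreeComplex k n) (i j : ℕ) : ℕ :=
  (Finset.univ.filter fun p : F.ι i => F.shift i p = j).card

theorem betti_shift_ne_zero (F : GradedFreeComplex k n) (i : ℕ) (p : F.ι i) :
    F.betti i (F.shift i p) ≠ 0 :=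
  Finset.card_ne_zero_of_mem (a := p) (by simp)

theorem d_d (F : GradedFreeComplex k n) (i) (x) : F.d i (F.d (i + 1) x) = 0 :=
  (F.exact_succ i _).2 ⟨x, rfl⟩

/-- The resolution of `R / L` obtained from a resolution of `L`. -/
theorem Resolves.exists_quotient {F : GradedFreeComplex k n} {L : Ideal (MvPolynomial (Fin n) k)}
    (hF : F.Resolves ⊥ L) (hmin : F.Minimal)
    (hL : ∀ r ∈ L, constantCoeff r = 0) :
    ∃ K : GradedFreeComplex k n, K.Resolves L ⊤ ∧ K.Minimal ∧
      (∀ j, K.betti 0 j = if j = 0 then 1 else 0) ∧ ∀ i j, K.betti (i + 1) j = F.betti i j := by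
  have haug : ∀ x, F.aug x ∈ L := fun x => by
    rw [← hF.1]
    exact Ideal.mem_sup_left ⟨x, rfl⟩
  let K : GradedFreeComplex k n :=
    { ι := fun i => Nat.casesOn i Unit F.ι
      fintype := fun i => by
        cases i
        · exact inferInstanceAs (Fintype Unit)
        · exact F.fintype _
      decEq := fun i => by
        cases i
        · exact inferInstanceAs (DecidableEq Unit)
        · exact F.decEq _
      shift := fun i => Nat.casesOn i (fun _ => 0) F.shift
      d := fun i => Nat.casesOn i (LinearMap.pi fun _ => F.aug) F.d
      aug := LinearMap.proj ()
      isHomMap_d := fun i => by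
        cases i
        · exact isHomMap_pi_iff.2 F.aug_homogeneous
        · exact F.isHomMap_d _
      aug_homogeneous := fun q => by
        convert isHomogeneous_one (Fin n) k
        exact Pi.single_eq_same (M := fun _ : Unit => MvPolynomial (Fin n) k) () 1
        rfl
      exact_succ := fun i x => by
        cases i
        · rw [← hF.2 x, Ideal.mem_bot]
          exact ⟨fun h => congrFun h (), fun h => funext fun _ => h⟩
        · exact F.exact_succ _ x
      finite_length := by
        obtain ⟨h, hh⟩ := F.finite_length
        refine ⟨h + 1, fun i hi => ?_⟩
        cases i with
        | zero => omega
        | succ i => exact hh i (by omega) }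
  refine ⟨K, ⟨?_, fun x => ?_⟩, fun i x p => ?_, fun j => ?_, fun i j => rfl⟩
  · rw [eq_top_iff]
    intro r _
    exact Ideal.mem_sup_left ⟨fun _ => r, rfl⟩
  · have h1 : (∃ y, K.d 0 y = x) ↔ ∃ y, F.aug y = x () :=
      exists_congr fun y => ⟨fun h => congrFun h (), fun h => funext fun _ => h⟩
    rw [h1, ← hF.1, sup_bot_eq]
    rfl
  · cases i
    -- The new first differential is the old augmentation; it is minimal because L has no elements
    -- with nonzero constant term.
    · exact hL _ (haug x)
    · exact hmin _ x p
  · change (Finset.univ.filter fun p : Unit => 0 = j).card = _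
    split_ifs with h
    · subst h
      rfl
    · rw [Finset.card_eq_zero, Finset.filter_eq_empty_iff]
      exact fun _ _ => Ne.symm h

/-- If `(I : u) = L`, then a resolution of `R / L` is, after a twist, one of `(I + (u)) / I`. -/
theorem Resolves.exists_twist {K : GradedFreeComplex k n} {L I : Ideal (MvPolynomial (Fin n) k)}
    (hK : K.Resolves L ⊤) (hmin : K.Minimal) {u : MvPolynomial (Fin n) k} {e : ℕ}
    (hu : u.IsHomogeneous e) (hL : ∀ r, r ∈ L ↔ r * u ∈ I) :
    ∃ G : GradedFreeComplex k n, G.Resolves I (I ⊔ Ideal.span {u}) ∧ G.Minimal ∧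
      ∀ i j, G.betti i j = if e ≤ j then K.betti i (j - e) else 0 := by
  let G : GradedFreeComplex k n :=
    { ι := K.ι
      shift := fun i p => K.shift i p + e
      d := K.d
      aug := u • K.aug
      isHomMap_d := fun i q => by
        rw [isHomVec_iff]
        intro p
        refine (isHomVec_iff.1 (K.isHomMap_d i q) p).imp_right ?_
        rintro ⟨m, hm, h⟩
        exact ⟨m, by dsimp only; omega, h⟩
      aug_homogeneous := fun q => by
        rw [add_comm]
        exact hu.mul (K.aug_homogeneous q)
      exact_succ := K.exact_succ
      finite_length := K.finite_length }
  refine ⟨G, ⟨?_, fun x => ?_⟩, hmin, fun i j => ?_⟩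
  · apply le_antisymm
    · refine sup_le ?_ le_sup_left
      rintro _ ⟨x, rfl⟩
      exact Ideal.mem_sup_right (Ideal.mul_mem_right _ _ (Ideal.mem_span_singleton_self u))
    · refine sup_le le_sup_right ?_
      rw [Ideal.span_singleton_le_iff_mem]
      have h1 : (1 : MvPolynomial (Fin n) k) ∈ LinearMap.range K.aug ⊔ L := by
        rw [hK.1]
        exact Submodule.mem_top
      -- Write 1 as an element of the image plus some `l` in L and multiply by `u`; then `l * u`
      -- falls into I.
      obtain ⟨_, ⟨x, rfl⟩, l, hl, hx⟩ := Submodule.mem_sup.1 h1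
      refine Submodule.mem_sup.2 ⟨_, ⟨x, rfl⟩, l * u, (hL l).1 hl, ?_⟩
      change u * K.aug x + l * u = u
      rw [mul_comm l, ← mul_add, hx, mul_one]
  · rw [← hK.2 x, hL, mul_comm]
    rfl
  · unfold betti
    split_ifs with h
    · congr 1
      ext p
      simp only [Finset.mem_filter, Finset.mem_univ, true_and]
      change K.shift i p + e = j ↔ _
      omega
    · rw [Finset.card_eq_zero, Finset.filter_eq_empty_iff]
      intro p _
      change ¬ K.shift i p + e = j
      omega

/-- The connecting maps of the horseshoe lemma. -/
theorem Resolves.exists_connecting {F G : GradedFreeComplex k n}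
    {M P : Ideal (MvPolynomial (Fin n) k)} (hF : F.Resolves ⊥ M) (hG : G.Resolves M P) :
    ∃ ψ : ∀ i, (G.ι (i + 1) → MvPolynomial (Fin n) k) →ₗ[MvPolynomial (Fin n) k]
        (F.ι i → MvPolynomial (Fin n) k),
      (∀ i, IsHomMap (F.shift i) (G.shift (i + 1)) (ψ i)) ∧
      (∀ x, F.aug (ψ 0 x) = -G.aug (G.d 0 x)) ∧
        ∀ i x, F.d i (ψ (i + 1) x) = -ψ i (G.d (i + 1) x) := by
  refine Exists.elim (exists_dependent_seq
    (α := fun i => (G.ι (i + 1) → MvPolynomial (Fin n) k) →ₗ[MvPolynomial (Fin n) k]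
        (F.ι i → MvPolynomial (Fin n) k))
    (P := fun i f => IsHomMap (F.shift i) (G.shift (i + 1)) f ∧
      (∀ x, f (G.d (i + 1) x) ∈ LinearMap.range (F.d i)) ∧
      ∀ h : i = 0, ∀ x, F.aug (h ▸ f x) = -G.aug (G.d 0 (h ▸ x)))
    (Q := fun i f f' => ∀ x, F.d i (f' x) = -f (G.d (i + 1) x)) ?_ ?_)
    fun f hf => ⟨f, fun i => (hf i).1.1, (hf 0).1.2.2 rfl, fun i => (hf i).2⟩
  · obtain ⟨f, h1, h2⟩ := exists_lift_functional F.aug_homogeneous (g := -(G.aug ∘ₗ G.d 0))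
      (u := G.shift 1)
      (fun q => by
        have h3 := (isHomMap_pi_iff.2 G.aug_homogeneous).apply (G.isHomMap_d 0 q)
        refine IsHomogeneous.neg ?_
        rcases isHomVec_iff.1 h3 () with h0 | ⟨m, hm, h⟩
        · change G.aug (G.d 0 (Pi.single q 1)) = 0 at h0
          change (G.aug (G.d 0 (Pi.single q 1))).IsHomogeneous _
          rw [h0]
          exact isHomogeneous_zero _ _ _
        · simp only [zero_add] at hm
          subst hm
          exact h)
      (fun x => by
        have h3 : -(G.aug (G.d 0 x)) ∈ M := neg_mem ((hG.2 _).2 ⟨x, rfl⟩)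
        rw [← hF.1, sup_bot_eq] at h3
        exact h3)
    have h2' : ∀ x, F.aug (f x) = -G.aug (G.d 0 x) := fun x => LinearMap.congr_fun h2 x
    refine ⟨f, h1, fun x => ?_, fun _ => h2'⟩
    obtain ⟨y, hy⟩ := (hF.2 (f (G.d 1 x))).1 (by rw [h2', G.d_d]; simp)
    exact ⟨y, hy⟩
  · rintro i f ⟨h1, h2, -⟩
    obtain ⟨f', h3, h4⟩ := (F.isHomMap_d i).exists_lift (u := G.shift (i + 2))
      (θ := -(f ∘ₗ G.d (i + 1)))
      (fun q => (h1.apply (G.isHomMap_d (i + 1) q)).neg) (fun x => neg_mem (h2 x))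
    have h4' : ∀ x, F.d i (f' x) = -f (G.d (i + 1) x) := fun x => LinearMap.congr_fun h4 x
    refine ⟨f', ⟨h3, fun x => ?_, fun h => by omega⟩, h4'⟩
    obtain ⟨y, hy⟩ := (F.exact_succ i (f' (G.d (i + 2) x))).1 (by rw [h4', G.d_d]; simp)
    exact ⟨y, hy⟩

/-- The horseshoe lemma for the inclusion of ideals `M ≤ P`. -/
theorem Resolves.exists_horseshoe {F G : GradedFreeComplex k n}
    {M P : Ideal (MvPolynomial (Fin n) k)} (hF : F.Resolves ⊥ M) (hG : G.Resolves M P)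
    (hFm : F.Minimal) (hGm : G.Minimal) (hs : ∀ i p q, F.shift i p ≠ G.shift (i + 1) q) :
    ∃ H : GradedFreeComplex k n, H.Resolves ⊥ P ∧ H.Minimal ∧
      ∀ i j, H.betti i j = F.betti i j + G.betti i j := by
  obtain ⟨ψ, hψ, hψ0, hψd⟩ := hF.exists_connecting hG
  -- The block triangular differential with diagonal blocks `F.d`, `G.d` and corner ψ; the sign in
  -- the relation for ψ makes its square vanish.
  let D : ∀ i, (F.ι (i + 1) ⊕ G.ι (i + 1) → MvPolynomial (Fin n) k) →ₗ[MvPolynomial (Fin n) k]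
      (F.ι i ⊕ G.ι i → MvPolynomial (Fin n) k) := fun i =>
    { toFun := fun v => Sum.elim (F.d i (v ∘ Sum.inl) + ψ i (v ∘ Sum.inr)) (G.d i (v ∘ Sum.inr))
      map_add' := fun v w => by
        have h1 : (v + w) ∘ Sum.inl = v ∘ Sum.inl + w ∘ Sum.inl := rfl
        have h2 : (v + w) ∘ Sum.inr = v ∘ Sum.inr + w ∘ Sum.inr := rfl
        rw [h1, h2]
        funext p
        rcases p with p | p <;> simp [add_add_add_comm]
      map_smul' := fun r v => by
        have h1 : (r • v) ∘ Sum.inl = r • v ∘ Sum.inl := rfl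
        have h2 : (r • v) ∘ Sum.inr = r • v ∘ Sum.inr := rfl
        rw [h1, h2]
        funext p
        rcases p with p | p <;> simp [mul_add] }
  have hD : ∀ i x y, D i (Sum.elim x y) = Sum.elim (F.d i x + ψ i y) (G.d i y) :=
    fun i x y => rfl
  let A : (F.ι 0 ⊕ G.ι 0 → MvPolynomial (Fin n) k) →ₗ[MvPolynomial (Fin n) k]
      MvPolynomial (Fin n) k :=
    F.aug ∘ₗ LinearMap.funLeft _ _ Sum.inl + G.aug ∘ₗ LinearMap.funLeft _ _ Sum.inr
  have hA : ∀ x y, A (Sum.elim x y) = F.aug x + G.aug y := fun x y => rfl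
  have helim : ∀ {α β : Type} (v : α ⊕ β → MvPolynomial (Fin n) k),
      ∃ x y, v = Sum.elim x y := fun v => ⟨_, _, (Sum.elim_comp_inl_inr v).symm⟩
  have hinl : ∀ {α β : Type} [DecidableEq α] [DecidableEq β] (q : α),
      (Pi.single (Sum.inl q) 1 : α ⊕ β → MvPolynomial (Fin n) k) =
        Sum.elim (Pi.single q 1) (0 : β → MvPolynomial (Fin n) k) := fun q => by
    funext p
    rcases p with p | p <;> simp [Pi.single_apply]
  have hinr : ∀ {α β : Type} [DecidableEq α] [DecidableEq β] (q : β),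
      (Pi.single (Sum.inr q) 1 : α ⊕ β → MvPolynomial (Fin n) k) =
        Sum.elim (0 : α → MvPolynomial (Fin n) k) (Pi.single q 1) := fun q => by
    funext p
    rcases p with p | p <;> simp [Pi.single_apply]
  have hhom : ∀ {i e} {x : F.ι i → MvPolynomial (Fin n) k} {y : G.ι i → MvPolynomial (Fin n) k},
      IsHomVec (F.shift i) e x → IsHomVec (G.shift i) e y →
      IsHomVec (Sum.elim (F.shift i) (G.shift i)) e (Sum.elim x y) := fun hx hy => by
    rw [isHomVec_iff] at *
    rintro (p | p)
    · exact hx p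
    · exact hy p
  let H : GradedFreeComplex k n :=
    { ι := fun i => F.ι i ⊕ G.ι i
      shift := fun i => Sum.elim (F.shift i) (G.shift i)
      d := D
      aug := A
      isHomMap_d := fun i q => by
        rcases q with q | q
        · rw [hinl, hD]
          refine hhom ?_ ?_
          · rw [map_zero, add_zero]
            exact F.isHomMap_d i q
          · rw [map_zero]
            exact isHomVec_zero _ _
        · rw [hinr, hD]
          refine hhom ?_ (G.isHomMap_d i q)
          rw [map_zero, zero_add]
          exact hψ i q
      aug_homogeneous := fun q => by
        rcases q with q | q
        · rw [hinl, hA, map_zero, add_zero]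
          exact F.aug_homogeneous q
        · rw [hinr, hA, map_zero, zero_add]
          exact G.aug_homogeneous q
      exact_succ := fun i v => by
        obtain ⟨x, y, rfl⟩ := helim v
        rw [hD]
        constructor
        · intro h
          have h1 : F.d i x + ψ i y = 0 := funext fun p => congrFun h (Sum.inl p)
          have h2 : G.d i y = 0 := funext fun p => congrFun h (Sum.inr p)
          obtain ⟨y', rfl⟩ := (G.exact_succ i y).1 h2
          obtain ⟨x', hx'⟩ := (F.exact_succ i (x - ψ (i + 1) y')).1 (by
            rw [map_sub, hψd, sub_neg_eq_add, h1])
          exact ⟨Sum.elim x' y', by rw [hD, hx', sub_add_cancel]⟩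
        · rintro ⟨w, hw⟩
          obtain ⟨x', y', rfl⟩ := helim w
          rw [hD] at hw
          have h1 : F.d (i + 1) x' + ψ (i + 1) y' = x := funext fun p => congrFun hw (Sum.inl p)
          have h2 : G.d (i + 1) y' = y := funext fun p => congrFun hw (Sum.inr p)
          subst h1 h2
          rw [map_add, F.d_d, hψd, G.d_d]
          funext p
          rcases p with p | p <;> simp
      finite_length := by
        obtain ⟨a, ha⟩ := F.finite_length
        obtain ⟨b, hb⟩ := G.finite_length
        refine ⟨max a b, fun i hi => ?_⟩
        have := ha i (by omega)
        have := hb i (by omega)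
        infer_instance }
  refine ⟨H, ⟨?_, fun v => ?_⟩, fun i v p => ?_, fun i j => ?_⟩
  · rw [← hG.1, ← hF.1, sup_bot_eq, sup_bot_eq]
    apply le_antisymm
    · rintro _ ⟨v, rfl⟩
      obtain ⟨x, y, rfl⟩ := helim v
      exact Submodule.mem_sup.2 ⟨G.aug y, ⟨y, rfl⟩, F.aug x, ⟨x, rfl⟩, add_comm _ _⟩
    · refine sup_le ?_ ?_
      · rintro _ ⟨y, rfl⟩
        exact ⟨Sum.elim 0 y, by change A _ = _; rw [hA, map_zero, zero_add]⟩
      · rintro _ ⟨x, rfl⟩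
        exact ⟨Sum.elim x 0, by change A _ = _; rw [hA, map_zero, add_zero]⟩
  · obtain ⟨x, y, rfl⟩ := helim v
    change A _ ∈ _ ↔ ∃ w, D 0 w = _
    rw [hA, Ideal.mem_bot]
    constructor
    · intro h
      obtain ⟨y', rfl⟩ := (hG.2 y).1 (by
        rw [eq_neg_of_add_eq_zero_right h, ← hF.1, sup_bot_eq]
        exact neg_mem ⟨x, rfl⟩)
      obtain ⟨x', hx'⟩ := (hF.2 (x - ψ 0 y')).1 (by
        rw [map_sub, hψ0, sub_neg_eq_add, h]
        exact Submodule.zero_mem _)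
      exact ⟨Sum.elim x' y', by rw [hD, hx', sub_add_cancel]⟩
    · rintro ⟨w, hw⟩
      obtain ⟨x', y', rfl⟩ := helim w
      rw [hD] at hw
      have h1 : F.d 0 x' + ψ 0 y' = x := funext fun p => congrFun hw (Sum.inl p)
      have h2 : G.d 0 y' = y := funext fun p => congrFun hw (Sum.inr p)
      subst h1 h2
      have h3 : F.aug (F.d 0 x') = 0 := (hF.2 _).2 ⟨x', rfl⟩
      rw [map_add, h3, hψ0]
      ring
  · obtain ⟨x, y, rfl⟩ := helim v
    change constantCoeff (D i (Sum.elim x y) p) = 0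
    rw [hD]
    rcases p with p | p
    · rw [Sum.elim_inl, Pi.add_apply, map_add, hFm, zero_add, constantCoeff_linearMap_apply]
      -- By `hs` the map ψ never joins basis elements of equal degree, so it has no constant
      -- entries.
      exact Finset.sum_eq_zero fun q _ => by rw [(hψ i q).constantCoeff_apply_eq_zero (hs i p q), mul_zero]
    · exact hGm i y p
  · change (Finset.univ.filter fun p : F.ι i ⊕ G.ι i =>
      Sum.elim (F.shift i) (G.shift i) p = j).card = _
    rw [Finset.card_filter, Fintype.sum_sum_type]
    unfold betti
    rw [Finset.card_filter, Finset.card_filter]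
    rfl

end GradedFreeComplex

/-! ### Betti numbers from linear quotients -/

section LinearQuotients

variable {k : Type*} [Field k] {n : ℕ}

/-- The ideal `I` has a minimal graded free resolution with Betti numbers `β`. -/
def HasMinimalResolution (I : Ideal (MvPolynomial (Fin n) k)) (β : ℕ → ℕ → ℕ) : Prop :=
  ∃ F : GradedFreeComplex k n, F.Resolves ⊥ I ∧ F.Minimal ∧ ∀ i j, F.betti i j = β i j

theorem hasMinimalResolution_bot :
    HasMinimalResolution (⊥ : Ideal (MvPolynomial (Fin n) k)) fun _ _ => 0 := by
  refine ⟨{ ι := fun _ => Empty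
            shift := fun _ _ => 0
            d := 0
            aug := 0
            isHomMap_d := fun _ q => q.elim
            aug_homogeneous := fun q => q.elim
            exact_succ := fun i x =>
              ⟨fun _ => ⟨0, Subsingleton.elim _ _⟩, fun _ => Subsingleton.elim _ _⟩
            finite_length := ⟨0, fun _ _ => inferInstanceAs (IsEmpty Empty)⟩ },
    ⟨?_, fun x => ?_⟩, fun _ _ p => p.elim, fun i j => rfl⟩
  · rw [sup_bot_eq, LinearMap.range_eq_bot]
  · exact ⟨fun _ => ⟨0, Subsingleton.elim (α := Empty → _) _ _⟩, fun _ => Submodule.zero_mem _⟩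

/-- Adding to `I` a form `u` of degree `e` whose colon ideal `L = (I : u)` is resolved by a
Koszul complex on `c` linear forms. -/
theorem HasMinimalResolution.sup_span_singleton {I L : Ideal (MvPolynomial (Fin n) k)}
    {β : ℕ → ℕ → ℕ} {c e : ℕ} {u : MvPolynomial (Fin n) k}
    (hI : HasMinimalResolution I β) (hβ : ∀ i j, e + i < j → β i j = 0)
    (hL : HasMinimalResolution L fun i j => if j = i + 1 then c.choose (i + 1) else 0)
    (hL0 : ∀ r ∈ L, constantCoeff r = 0) (hu : u.IsHomogeneous e)
    (hcolon : ∀ r, r ∈ L ↔ r * u ∈ I) :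
    HasMinimalResolution (I ⊔ Ideal.span {u})
      fun i j => β i j + if j = e + i then c.choose i else 0 := by
  obtain ⟨F, hF, hFm, hFβ⟩ := hI
  obtain ⟨K, hK, hKm, hKβ⟩ := hL
  dsimp only at hKβ
  obtain ⟨K', hK', hKm', hK0, hKs⟩ := hK.exists_quotient hKm hL0
  obtain ⟨G, hG, hGm, hGβ⟩ := hK'.exists_twist hKm' hu hcolon
  have hG' : ∀ i j, G.betti i j = if j = e + i then c.choose i else 0 := by
    intro i j
    rw [hGβ]
    rcases i with _ | i
    · rw [hK0]
      by_cases h : j = e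
      · simp [h]
      · rw [if_neg (show ¬ j = e + 0 by omega)]
        split_ifs
        · omega
        · rfl
        · rfl
    · rw [hKs, hKβ]
      by_cases h : j = e + (i + 1)
      · rw [if_pos h, if_pos (by omega), if_pos (by omega)]
      · rw [if_neg h]
        split_ifs
        · omega
        · rfl
        · rfl
  -- Shifts of F in homological degree `i` are at most `e + i`, those of G in degree `i + 1` equal
  -- `e + i + 1`: they never meet.
  obtain ⟨H, hH, hHm, hHβ⟩ := hF.exists_horseshoe hG hFm hGm (fun i p q => by
    have h1 := F.betti_shift_ne_zero i p
    have h2 := G.betti_shift_ne_zero (i + 1) q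
    rw [hFβ] at h1
    rw [hG'] at h2
    have h3 : ¬ e + i < F.shift i p := fun h => h1 (hβ _ _ h)
    have h4 : G.shift (i + 1) q = e + (i + 1) := by
      by_contra h
      exact h2 (if_neg h)
    omega)
  exact ⟨H, hH, hHm, fun i j => by rw [hHβ, hFβ, hG']⟩

/-- A variable outside `S` is a nonzerodivisor modulo the prime generated by `S`. -/
theorem mul_X_mem_varIdeal_iff {S : Finset (Fin n)} {x : Fin n} (hx : x ∉ S)
    (r : MvPolynomial (Fin n) k) : r ∈ varIdeal k S ↔ r * X x ∈ varIdeal k S := by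
  refine ⟨fun h => Ideal.mul_mem_right _ _ h, fun h => ?_⟩
  rw [mem_varIdeal_iff] at h ⊢
  intro m hm
  obtain ⟨j, hj, hmj⟩ := h (m + Finsupp.single x 1) (by
    rw [support_mul_X]
    exact Finset.mem_map_of_mem _ hm)
  refine ⟨j, hj, ?_⟩
  have : x ≠ j := fun h => hx (h ▸ hj)
  simpa [Finsupp.single_eq_of_ne this.symm] using hmj

/-- The Koszul complex. -/
theorem hasMinimalResolution_varIdeal (S : Finset (Fin n)) :
    HasMinimalResolution (varIdeal k S)
      fun i j => if j = i + 1 then S.card.choose (i + 1) else 0 := by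
  induction S using Finset.induction_on with
  | empty =>
    have h1 : varIdeal k (∅ : Finset (Fin n)) = ⊥ := by simp [varIdeal]
    rw [h1]
    convert hasMinimalResolution_bot (k := k) (n := n) using 3
    simp
  | insert x S hx ih =>
    have h1 : varIdeal k (insert x S) = varIdeal k S ⊔ Ideal.span {X x} := by
      rw [varIdeal, Finset.coe_insert, Set.image_insert_eq, Ideal.span_insert, sup_comm]
      rfl
    rw [h1]
    -- The induction hypothesis is used twice, as resolution of the ideal and of its colon ideal,
    -- which coincide; Pascal's rule adds the ranks.
    convert ih.sup_span_singleton (e := 1) (fun i j h => if_neg (by omega)) ih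
      (fun r => constantCoeff_eq_zero_of_mem_varIdeal) (isHomogeneous_X k x)
      (mul_X_mem_varIdeal_iff hx) using 3 with i j
    rw [Finset.card_insert_of_notMem hx, Nat.choose_succ_succ, add_comm 1 i]
    split_ifs
    · rw [add_comm]
    · rfl

/-- Criterion for a colon ideal by a monomial to be generated by variables: `h1` puts each variable
of `S` into it, and `h2` makes every monomial of it divisible by one of them. -/
theorem mul_monomial_mem_span_iff {s : Finset (Fin n →₀ ℕ)} {u : Fin n →₀ ℕ}
    {S : Finset (Fin n)} (h1 : ∀ l ∈ S, ∃ v ∈ s, v ≤ u + Finsupp.single l 1)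
    (h2 : ∀ v ∈ s, ∃ l ∈ S, u l < v l) (r : MvPolynomial (Fin n) k) :
    r ∈ varIdeal k S ↔
      r * monomial u 1 ∈ Ideal.span ((fun v => monomial v (1 : k)) '' (s : Set (Fin n →₀ ℕ))) := by
  classical
  rw [mem_varIdeal_iff, mem_ideal_span_monomial_image]
  constructor
  · intro h m hm
    obtain ⟨m', hm', rfl⟩ : ∃ m' ∈ r.support, m' + u = m := by
      have := support_mul _ _ hm
      obtain ⟨a, ha, b, hb, hab⟩ := Finset.mem_add.1 this
      have hb' := Finset.mem_singleton.1 (support_monomial_subset hb)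
      exact ⟨a, ha, by rw [← hab, hb']⟩
    obtain ⟨l, hl, hml⟩ := h m' hm'
    obtain ⟨v, hv, hvu⟩ := h1 l hl
    refine ⟨v, hv, hvu.trans ?_⟩
    rw [add_comm]
    gcongr
    rw [Finsupp.single_le_iff]
    omega
  · intro h m hm
    obtain ⟨v, hv, hvm⟩ := h (m + u) (by
      rw [mem_support_iff, coeff_mul_monomial, mul_one]
      exact mem_support_iff.1 hm)
    obtain ⟨l, hl, hul⟩ := h2 v hv
    refine ⟨l, hl, ?_⟩
    have := hvm l
    rw [Finsupp.add_apply] at this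
    omega

/-- Betti numbers of monomial ideals with linear quotients. -/
theorem hasMinimalResolution_of_linearQuotients {α : Type*} [LinearOrder α]
    (f : (Fin n →₀ ℕ) → α) (hf : Function.Injective f)
    (hdeg : ∀ u v, f u < f v → u.degree ≤ v.degree)
    (S : (Fin n →₀ ℕ) → Finset (Fin n)) (s : Finset (Fin n →₀ ℕ))
    (h1 : ∀ u ∈ s, ∀ l ∈ S u, ∃ v ∈ s, f v < f u ∧ v ≤ u + Finsupp.single l 1)
    (h2 : ∀ u ∈ s, ∀ v ∈ s, f v < f u → ∃ l ∈ S u, u l < v l) :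
    HasMinimalResolution
      (Ideal.span ((fun v => monomial v (1 : k)) '' (s : Set (Fin n →₀ ℕ))))
      fun i j => ∑ u ∈ s, if j = u.degree + i then (S u).card.choose i else 0 := by
  classical
  induction s using Finset.induction_on_max_value f with
  | empty =>
    simp only [Finset.coe_empty, Set.image_empty, Ideal.span_empty, Finset.sum_empty]
    exact hasMinimalResolution_bot
  | insert a s has hmax ih =>
    have hlt : ∀ v ∈ s, f v < f a := fun v hv =>
      lt_of_le_of_ne (hmax v hv) fun h => has (hf h ▸ hv)
    have ih' := ih
      (fun u hu l hl => by
        obtain ⟨v, hv, hvu, hle⟩ := h1 u (Finset.mem_insert_of_mem hu) l hl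
        rcases Finset.mem_insert.1 hv with rfl | hv
        · exact absurd hvu (hlt u hu).not_gt
        · exact ⟨v, hv, hvu, hle⟩)
      (fun u hu v hv => h2 u (Finset.mem_insert_of_mem hu) v (Finset.mem_insert_of_mem hv))
    have hspan : Ideal.span ((fun v => monomial v (1 : k)) ''
        ((insert a s : Finset (Fin n →₀ ℕ)) : Set (Fin n →₀ ℕ))) =
        Ideal.span ((fun v => monomial v (1 : k)) '' (s : Set (Fin n →₀ ℕ))) ⊔
          Ideal.span {monomial a 1} := by
      rw [Finset.coe_insert, Set.image_insert_eq, Ideal.span_insert, sup_comm]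
    rw [hspan]
    convert ih'.sup_span_singleton (e := a.degree) (fun i j h => ?_)
      (hasMinimalResolution_varIdeal (S a))
      (fun r => constantCoeff_eq_zero_of_mem_varIdeal)
      (isHomogeneous_monomial (1 : k) rfl)
      (mul_monomial_mem_span_iff
        (fun l hl => by
          obtain ⟨v, hv, hva, hle⟩ := h1 a (Finset.mem_insert_self _ _) l hl
          rcases Finset.mem_insert.1 hv with rfl | hv
          · exact absurd hva (lt_irrefl _)
          · exact ⟨v, hv, hle⟩)
        (fun v hv => h2 a (Finset.mem_insert_self _ _) v (Finset.mem_insert_of_mem hv)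
          (hlt v hv))) using 3 with i j
    · rw [Finset.sum_insert has, add_comm]
    -- Earlier generators have degree at most that of `a`, so nothing lies above the strand of `a`.
    · refine Finset.sum_eq_zero fun v hv => if_neg ?_
      have := hdeg v a (hlt v hv)
      omega

/-- Reindexing the bases by `Fin`. -/
theorem HasMinimalResolution.exists_gradedFreeResolution
    {I : Ideal (MvPolynomial (Fin n) k)} {β : ℕ → ℕ → ℕ} (h : HasMinimalResolution I β) :
    ∃ F : GradedFreeResolution I, F.IsMinimal ∧ ∀ i j, F.betti i j = β i j := by
  obtain ⟨F, hF, hFm, hβ⟩ := h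
  let e : ∀ i, F.ι i ≃ Fin (Fintype.card (F.ι i)) := fun i => Fintype.equivFin _
  let E : ∀ i, (Fin (Fintype.card (F.ι i)) → MvPolynomial (Fin n) k) ≃ₗ[MvPolynomial (Fin n) k]
      (F.ι i → MvPolynomial (Fin n) k) := fun i => LinearEquiv.funCongrLeft _ _ (e i)
  have hE : ∀ i q, E i (Pi.single q 1) = Pi.single ((e i).symm q) 1 := by
    intro i q
    funext p
    change (Pi.single q 1 : Fin _ → MvPolynomial (Fin n) k) (e i p) = _
    simp [Pi.single_apply, Equiv.eq_symm_apply]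
  have hEs : ∀ i v p, (E i).symm v p = v ((e i).symm p) := fun i v p => rfl
  let G : GradedFreeResolution I :=
    { rank := fun i => Fintype.card (F.ι i)
      shift := fun i p => F.shift i ((e i).symm p)
      d := fun i => (E i).symm.toLinearMap ∘ₗ F.d i ∘ₗ (E (i + 1)).toLinearMap
      aug := F.aug ∘ₗ (E 0).toLinearMap
      d_homogeneous := fun i q p => by
        have := isHomVec_iff.1 (F.isHomMap_d i ((e (i + 1)).symm q)) ((e i).symm p)
        simpa only [LinearMap.comp_apply, LinearEquiv.coe_coe, hE, hEs] using this
      aug_homogeneous := fun q => by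
        simpa only [LinearMap.comp_apply, LinearEquiv.coe_coe, hE] using
          F.aug_homogeneous ((e 0).symm q)
      range_aug := by
        rw [LinearMap.range_comp_of_range_eq_top _ (LinearEquiv.range _), ← hF.1, sup_bot_eq]
      exact_zero := by
        ext v
        rw [LinearMap.mem_ker, LinearMap.comp_apply, LinearEquiv.coe_coe]
        have h1 := hF.2 (E 0 v)
        rw [Ideal.mem_bot] at h1
        rw [h1]
        constructor
        · rintro ⟨w, rfl⟩
          exact ⟨E 1 w, by simp⟩
        · rintro ⟨w, hw⟩
          exact ⟨(E 1).symm w, by simp [hw]⟩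
      exact_succ := fun i => by
        ext v
        rw [LinearMap.mem_ker, LinearMap.comp_apply, LinearMap.comp_apply, LinearEquiv.coe_coe,
          LinearEquiv.coe_coe, LinearEquiv.map_eq_zero_iff, F.exact_succ]
        constructor
        · rintro ⟨w, rfl⟩
          exact ⟨E (i + 2) w, by simp⟩
        · rintro ⟨w, hw⟩
          exact ⟨(E (i + 2)).symm w, by simp [hw]⟩
      finite_length := by
        obtain ⟨b, hb⟩ := F.finite_length
        exact ⟨b, fun i hi => Fintype.card_eq_zero_iff.2 (hb i hi)⟩ }
  refine ⟨G, fun i => ?_, fun i j => ?_⟩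
  · rintro _ ⟨v, rfl⟩
    exact mem_varIdeal_univ_smul_top_iff.2 fun p => hFm i _ _
  · rw [← hβ]
    refine Finset.card_bij (fun p _ => (e i).symm p) (fun p hp => ?_)
      (fun _ _ _ _ h => (e i).symm.injective h) (fun p hp => ⟨e i p, ?_, by simp⟩)
    · simpa using hp
    · simpa [G] using hp

theorem HasMinimalResolution.hasGradedBetti
    {I : Ideal (MvPolynomial (Fin n) k)} {β : ℕ → ℕ → ℕ} (h : HasMinimalResolution I β)
    (i j : ℕ) : HasGradedBetti I i j (β i j) := by
  obtain ⟨F, hF, hβ⟩ := h.exists_gradedFreeResolution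
  exact hβ i j ▸ F.hasGradedBetti hF i j

end LinearQuotients

/-! ### Products of monomial ideals and counting of monomials -/

section MonomialIdeals

open scoped Pointwise

variable {n : ℕ}

/-- The ideal generated by the monomials with exponents in `s`. -/
noncomputable def monomialIdeal (k : Type*) [Field k] (s : Finset (Fin n →₀ ℕ)) :
    Ideal (MvPolynomial (Fin n) k) :=
  Ideal.span ((fun v => monomial v (1 : k)) '' (s : Set (Fin n →₀ ℕ)))

variable {k : Type*} [Field k]

theorem monomialIdeal_mul (s t : Finset (Fin n →₀ ℕ)) :
    monomialIdeal k s * monomialIdeal k t = monomialIdeal k (s + t) := by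
  rw [monomialIdeal, monomialIdeal, monomialIdeal, Ideal.span_mul_span']
  congr 1
  rw [Finset.coe_add]
  ext x
  simp only [Set.mem_mul, Set.mem_image, Set.mem_add]
  constructor
  · rintro ⟨_, ⟨a, ha, rfl⟩, _, ⟨b, hb, rfl⟩, rfl⟩
    exact ⟨_, ⟨a, ha, b, hb, rfl⟩, by simp [monomial_mul]⟩
  · rintro ⟨_, ⟨a, ha, b, hb, rfl⟩, rfl⟩
    exact ⟨_, ⟨a, ha, rfl⟩, _, ⟨b, hb, rfl⟩, by simp [monomial_mul]⟩

theorem sum_monomialIdeal {ι : Type*} [DecidableEq ι] (T : Finset ι)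
    (s : ι → Finset (Fin n →₀ ℕ)) :
    ∑ t ∈ T, monomialIdeal k (s t) = monomialIdeal k (T.biUnion s) := by
  induction T using Finset.induction_on with
  | empty => simp [monomialIdeal]
  | insert a T ha ih =>
    rw [Finset.sum_insert ha, ih, Finset.biUnion_insert, monomialIdeal, monomialIdeal,
      monomialIdeal, Finset.coe_union, Set.image_union, Ideal.span_union, Submodule.add_eq_sup]

theorem mem_finsuppAntidiag_iff {T : Finset (Fin n)} {d : ℕ} {u : Fin n →₀ ℕ} :
    u ∈ T.finsuppAntidiag d ↔ ∑ x ∈ T, u x = d ∧ u.support ⊆ T :=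
  Finset.mem_finsuppAntidiag

theorem finsuppAntidiag_add_singles (T : Finset (Fin n)) (d : ℕ) :
    T.finsuppAntidiag d + T.image (fun j => Finsupp.single j 1) = T.finsuppAntidiag (d + 1) := by
  ext u
  simp only [Finset.mem_add, Finset.mem_image, mem_finsuppAntidiag_iff]
  constructor
  · rintro ⟨v, ⟨hv, hvT⟩, _, ⟨j, hj, rfl⟩, rfl⟩
    refine ⟨?_, Finsupp.support_add.trans (Finset.union_subset hvT ?_)⟩
    · simp [Finset.sum_add_distrib, hv, Finsupp.single_apply, hj]
    · exact Finsupp.support_single_subset.trans (by simpa using hj)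
  · rintro ⟨hu, huT⟩
    obtain ⟨j, hj, huj⟩ := Finset.exists_ne_zero_of_sum_ne_zero (by rw [hu]; omega)
    have hle : Finsupp.single j 1 ≤ u := by
      rw [Finsupp.single_le_iff]
      omega
    refine ⟨u - Finsupp.single j 1, ⟨?_, Finsupp.support_tsub.trans huT⟩, _, ⟨j, hj, rfl⟩,
      tsub_add_cancel_of_le hle⟩
    have h1 := congrArg (fun v : Fin n →₀ ℕ => ∑ x ∈ T, v x) (tsub_add_cancel_of_le hle)
    simp only [Finsupp.add_apply, Finset.sum_add_distrib, hu] at h1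
    rw [Finset.sum_eq_single_of_mem (f := (Finsupp.single j 1 : Fin n →₀ ℕ)) j hj
      (fun x _ hx => Finsupp.single_eq_of_ne hx), Finsupp.single_eq_same] at h1
    omega

theorem varIdeal_pow (T : Finset (Fin n)) (d : ℕ) :
    varIdeal k T ^ d = monomialIdeal k (T.finsuppAntidiag d) := by
  have h1 : varIdeal k T = monomialIdeal k (T.image fun j => Finsupp.single j 1) := by
    rw [varIdeal, monomialIdeal, Finset.coe_image, Set.image_image]
    rfl
  induction d with
  | zero => simp [monomialIdeal]
  | succ d ih => rw [pow_succ, ih, h1, monomialIdeal_mul, finsuppAntidiag_add_singles]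

theorem sum_eq_zero_of_disjoint {A B : Finset (Fin n)} (h : Disjoint A B) {β : Fin n →₀ ℕ}
    (hβ : β.support ⊆ B) : ∑ x ∈ A, β x = 0 :=
  Finset.sum_eq_zero fun x hx => by
    by_contra hc
    exact Finset.disjoint_left.1 h hx (hβ (Finsupp.mem_support_iff.2 hc))

theorem mem_add_add_finsuppAntidiag {A B C : Finset (Fin n)} (hAB : Disjoint A B)
    (hAC : Disjoint A C) (hBC : Disjoint B C) {p q r : ℕ} {u : Fin n →₀ ℕ} :
    u ∈ B.finsuppAntidiag q + A.finsuppAntidiag p + C.finsuppAntidiag r ↔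
      (∀ x, u x ≠ 0 → x ∈ A ∨ x ∈ B ∨ x ∈ C) ∧
        ∑ x ∈ A, u x = p ∧ ∑ x ∈ B, u x = q ∧ ∑ x ∈ C, u x = r := by
  simp only [Finset.mem_add, mem_finsuppAntidiag_iff]
  constructor
  · rintro ⟨_, ⟨β, ⟨hβ, hβB⟩, α, ⟨hα, hαA⟩, rfl⟩, γ, ⟨hγ, hγC⟩, rfl⟩
    refine ⟨fun x hx => ?_, ?_, ?_, ?_⟩
    · by_contra! hc
      have h1 : α x = 0 := by
        by_contra h
        exact hc.1 (hαA (Finsupp.mem_support_iff.2 h))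
      have h2 : β x = 0 := by
        by_contra h
        exact hc.2.1 (hβB (Finsupp.mem_support_iff.2 h))
      have h3 : γ x = 0 := by
        by_contra h
        exact hc.2.2 (hγC (Finsupp.mem_support_iff.2 h))
      exact hx (by simp [h1, h2, h3])
    · simp only [Finsupp.add_apply, Finset.sum_add_distrib, sum_eq_zero_of_disjoint hAB hβB,
        sum_eq_zero_of_disjoint hAC hγC]
      simpa using hα
    · simp only [Finsupp.add_apply, Finset.sum_add_distrib, sum_eq_zero_of_disjoint hAB.symm hαA,
        sum_eq_zero_of_disjoint hBC hγC]
      simpa using hβ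
    · simp only [Finsupp.add_apply, Finset.sum_add_distrib, sum_eq_zero_of_disjoint hAC.symm hαA,
        sum_eq_zero_of_disjoint hBC.symm hβB]
      simpa using hγ
  · rintro ⟨hu, hA, hB, hC⟩
    have hf : ∀ T : Finset (Fin n), ∑ x ∈ T, u.filter (· ∈ T) x = ∑ x ∈ T, u x := fun T =>
      Finset.sum_congr rfl fun x hx => Finsupp.filter_apply_pos (· ∈ T) u hx
    have hs : ∀ T : Finset (Fin n), (u.filter (· ∈ T)).support ⊆ T := fun T x hx => by
      rw [Finsupp.support_filter] at hx
      exact (Finset.mem_filter.1 hx).2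
    refine ⟨_, ⟨u.filter (· ∈ B), ⟨(hf B).trans hB, hs B⟩, u.filter (· ∈ A),
      ⟨(hf A).trans hA, hs A⟩, rfl⟩, u.filter (· ∈ C), ⟨(hf C).trans hC, hs C⟩, ?_⟩
    ext x
    simp only [Finsupp.add_apply, Finsupp.filter_apply]
    by_cases hx : u x = 0
    · simp [hx]
    · rcases hu x hx with h | h | h
      · simp [h, Finset.disjoint_left.1 hAB h, Finset.disjoint_left.1 hAC h]
      · simp [h, Finset.disjoint_right.1 hAB h, Finset.disjoint_left.1 hBC h]
      · simp [h, Finset.disjoint_right.1 hAC h, Finset.disjoint_right.1 hBC h]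

/-- The elements of `T` that come after the first variable of `T` dividing the monomial `u`. -/
def laterVars (T : Finset (Fin n)) (u : Fin n →₀ ℕ) : Finset (Fin n) :=
  T.filter fun l => ∃ i ∈ T, i < l ∧ u i ≠ 0

theorem laterVars_congr {T : Finset (Fin n)} {u v : Fin n →₀ ℕ} (h : ∀ x ∈ T, u x = v x) :
    laterVars T u = laterVars T v := by
  refine Finset.filter_congr fun l _ => ?_
  constructor
  · rintro ⟨i, hi, hil, hu⟩
    exact ⟨i, hi, hil, h i hi ▸ hu⟩
  · rintro ⟨i, hi, hil, hu⟩
    exact ⟨i, hi, hil, (h i hi).symm ▸ hu⟩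

/-- Induction on `T` by adjoining a new smallest variable `a`. Monomials not divisible by `a` come
from `T`; for the others all of `T` is later, and Pascal's rule counts them. The degree is written
`e + 1` because the monomial 1 has no first variable. -/
theorem sum_laterVars (T : Finset (Fin n)) (e : ℕ) (g : ℕ → ℕ) :
    ∑ α ∈ T.finsuppAntidiag (e + 1), g (laterVars T α).card =
      ∑ m ∈ Finset.range T.card, (m + e).choose e * g m := by
  induction T using Finset.induction_on_min with
  | empty => simp
  | insert a T hT ih =>
    have haT : a ∉ T := fun h => lt_irrefl _ (hT a h)
    have h0 : ((insert a T).finsuppAntidiag (e + 1)).filter (fun α => α a = 0) =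
        T.finsuppAntidiag (e + 1) := by
      ext α
      simp only [Finset.mem_filter, Finset.mem_finsuppAntidiag, Finset.sum_insert haT]
      constructor
      · rintro ⟨⟨h1, h2⟩, h3⟩
        refine ⟨by rw [h3, zero_add] at h1; exact h1, fun x hx => ?_⟩
        rcases Finset.mem_insert.1 (h2 hx) with rfl | h
        · exact absurd h3 (Finsupp.mem_support_iff.1 hx)
        · exact h
      · rintro ⟨h1, h2⟩
        have h3 : α a = 0 := by
          by_contra h
          exact haT (h2 (Finsupp.mem_support_iff.2 h))
        exact ⟨⟨by rw [h3, zero_add]; exact h1, h2.trans (Finset.subset_insert _ _)⟩, h3⟩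
    have h1 : (((insert a T).finsuppAntidiag (e + 1)).filter (fun α => ¬ α a = 0)).card =
        (T.card + e).choose e := by
      have h2 := Finset.card_filter_add_card_filter_not
        (s := (insert a T).finsuppAntidiag (e + 1)) (fun α => α a = 0)
      rw [h0, Finset.card_finsuppAntidiag_nat_eq_choose, Finset.card_finsuppAntidiag_nat_eq_choose,
        Finset.card_insert_of_notMem haT, show T.card + 1 + (e + 1) - 1 = T.card + e + 1 by omega,
        show T.card + (e + 1) - 1 = T.card + e by omega, Nat.choose_succ_succ'] at h2
      omega
    rw [← Finset.sum_filter_add_sum_filter_not _ (fun α => α a = 0), h0,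
      Finset.card_insert_of_notMem haT, Finset.sum_range_succ, ← ih]
    congr 1
    · refine Finset.sum_congr rfl fun α hα => ?_
      congr 2
      have h3 : α a = 0 := by
        by_contra h
        exact haT ((Finset.mem_finsuppAntidiag.1 hα).2 (Finsupp.mem_support_iff.2 h))
      ext l
      simp only [laterVars, Finset.mem_filter, Finset.mem_insert]
      constructor
      · rintro ⟨hl, i, rfl | hi, hil, hαi⟩
        · exact absurd h3 hαi
        · rcases hl with rfl | hl
          · exact absurd (hT i hi) hil.not_gt
          · exact ⟨hl, i, hi, hil, hαi⟩
      · rintro ⟨hl, i, hi, hil, hαi⟩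
        exact ⟨Or.inr hl, i, Or.inr hi, hil, hαi⟩
    · rw [← h1, Finset.card_eq_sum_ones, Finset.sum_mul]
      refine Finset.sum_congr rfl fun α hα => ?_
      rw [one_mul]
      congr 2
      have h3 := (Finset.mem_filter.1 hα).2
      ext l
      simp only [laterVars, Finset.mem_filter, Finset.mem_insert]
      constructor
      · rintro ⟨rfl | hl, i, rfl | hi, hil, -⟩
        · exact absurd hil (lt_irrefl _)
        · exact absurd (hT i hi) hil.not_gt
        · exact hl
        · exact hl
      · exact fun hl => ⟨Or.inr hl, a, Or.inl rfl, hT l hl, h3⟩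

theorem sum_range_choose_mul_choose (p e i : ℕ) :
    ∑ m ∈ Finset.range p, (m + e).choose e * m.choose i =
      (p + e).choose (e + 1 + i) * (e + i).choose i := by
  induction p with
  | zero => simp [Nat.choose_eq_zero_of_lt (show e < e + 1 + i by omega)]
  | succ p ih =>
    -- Both sides count the ways to choose disjoint subsets of sizes `e` and `i` in a set of `p + e`
    -- elements.
    have h : (p + e).choose e * p.choose i = (p + e).choose (e + i) * (e + i).choose i := by
      rcases le_or_gt i p with hip | hip
      · have := Nat.choose_mul (n := p + e) (k := e + i) (s := e) (by omega)
        rw [Nat.add_sub_cancel, Nat.add_sub_cancel_left] at this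
        rw [← this, ← Nat.choose_symm_add]
      · rw [Nat.choose_eq_zero_of_lt hip, Nat.choose_eq_zero_of_lt (show p + e < e + i by omega)]
        simp
    rw [Finset.sum_range_succ, ih, h, show p + 1 + e = p + e + 1 by omega,
      show e + 1 + i = e + i + 1 by omega, Nat.choose_succ_succ]
    ring

theorem sum_choose_laterVars (T : Finset (Fin n)) (e i : ℕ) :
    ∑ α ∈ T.finsuppAntidiag (e + 1), (laterVars T α).card.choose i =
      (T.card + e).choose (e + 1 + i) * (e + i).choose i := by
  rw [sum_laterVars T e fun m => m.choose i, sum_range_choose_mul_choose]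

theorem add_add_choose_eq_sum_antidiagonalTuple (x y z i : ℕ) :
    (x + y + z).choose i = ∑ t ∈ Finset.Nat.antidiagonalTuple 3 i,
      x.choose (t 0) * y.choose (t 1) * z.choose (t 2) := by
  rw [add_assoc, Nat.add_choose_eq]
  simp only [Nat.add_choose_eq, Finset.mul_sum]
  rw [Finset.sum_sigma']
  refine Finset.sum_bij' (fun p _ => ![p.1.1, p.2.1, p.2.2])
    (fun t _ => ⟨(t 0, t 1 + t 2), (t 1, t 2)⟩) ?_ ?_ ?_ ?_ ?_
  · rintro ⟨⟨a, b⟩, ⟨c, d⟩⟩ h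
    simp only [Finset.mem_sigma, Finset.HasAntidiagonal.mem_antidiagonal] at h
    simp [Finset.Nat.mem_antidiagonalTuple, Fin.sum_univ_three]
    omega
  · intro t h
    simp only [Finset.Nat.mem_antidiagonalTuple, Fin.sum_univ_three] at h
    simp only [Finset.mem_sigma, Finset.HasAntidiagonal.mem_antidiagonal]
    exact ⟨by rw [← h, add_assoc], trivial⟩
  · rintro ⟨⟨a, b⟩, ⟨c, d⟩⟩ h
    simp only [Finset.mem_sigma, Finset.HasAntidiagonal.mem_antidiagonal] at h
    obtain ⟨-, rfl⟩ := h
    rfl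
  · intro t h
    funext j
    fin_cases j <;> rfl
  · rintro ⟨⟨a, b⟩, ⟨c, d⟩⟩ h
    simp [mul_assoc]

end MonomialIdeals

/-! ### The generators of V and their colon ideals -/

section IdealV

open scoped Pointwise

variable {n : ℕ}

theorem apply_eq_zero_of_disjoint {A B : Finset (Fin n)} (h : Disjoint A B) {β : Fin n →₀ ℕ}
    (hβ : β.support ⊆ B) {x : Fin n} (hx : x ∈ A) : β x = 0 := by
  by_contra hc
  exact Finset.disjoint_left.1 h hx (hβ (Finsupp.mem_support_iff.2 hc))

theorem sum_add_add_finsuppAntidiag {A B C : Finset (Fin n)} (hAB : Disjoint A B)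
    (hAC : Disjoint A C) (hBC : Disjoint B C) (p q r : ℕ) (g : (Fin n →₀ ℕ) → ℕ) :
    ∑ u ∈ B.finsuppAntidiag q + A.finsuppAntidiag p + C.finsuppAntidiag r, g u =
      ∑ α ∈ A.finsuppAntidiag p, ∑ β ∈ B.finsuppAntidiag q, ∑ γ ∈ C.finsuppAntidiag r,
        g (β + α + γ) := by
  rw [← Finset.sum_product', ← Finset.sum_product']
  symm
  refine Finset.sum_bij (fun x _ => x.1.2 + x.1.1 + x.2) ?_ ?_ ?_ (fun _ _ => rfl)
  · rintro ⟨⟨α, β⟩, γ⟩ h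
    simp only [Finset.mem_product] at h
    exact Finset.add_mem_add (Finset.add_mem_add h.1.2 h.1.1) h.2
  · rintro ⟨⟨α, β⟩, γ⟩ h ⟨⟨α', β'⟩, γ'⟩ h' heq
    simp only [Finset.mem_product, mem_finsuppAntidiag_iff] at h h'
    obtain ⟨⟨⟨-, hα⟩, -, hβ⟩, -, hγ⟩ := h
    obtain ⟨⟨⟨-, hα'⟩, -, hβ'⟩, -, hγ'⟩ := h'
    have key : ∀ x, β x + α x + γ x = β' x + α' x + γ' x := fun x => DFunLike.congr_fun heq x
    have hz : ∀ {T : Finset (Fin n)} {v : Fin n →₀ ℕ}, v.support ⊆ T → ∀ x, x ∉ T → v x = 0 :=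
      fun hv x hx => Finsupp.notMem_support_iff.1 fun h => hx (hv h)
    have e1 : α = α' := by
      ext x
      by_cases hx : x ∈ A
      · have := key x
        rwa [apply_eq_zero_of_disjoint hAB hβ hx, apply_eq_zero_of_disjoint hAB hβ' hx,
          apply_eq_zero_of_disjoint hAC hγ hx, apply_eq_zero_of_disjoint hAC hγ' hx, zero_add,
          zero_add] at this
      · rw [hz hα x hx, hz hα' x hx]
    have e2 : β = β' := by
      ext x
      by_cases hx : x ∈ B
      · have := key x
        rwa [apply_eq_zero_of_disjoint hAB.symm hα hx, apply_eq_zero_of_disjoint hAB.symm hα' hx,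
          apply_eq_zero_of_disjoint hBC hγ hx, apply_eq_zero_of_disjoint hBC hγ' hx] at this
      · rw [hz hβ x hx, hz hβ' x hx]
    have e3 : γ = γ' := by
      subst e1 e2
      exact add_left_cancel heq
    rw [e1, e2, e3]
  · intro u hu
    obtain ⟨v, hv, γ, hγ, rfl⟩ := Finset.mem_add.1 hu
    obtain ⟨β, hβ, α, hα, rfl⟩ := Finset.mem_add.1 hv
    exact ⟨((α, β), γ), by simp only [Finset.mem_product]; exact ⟨⟨hα, hβ⟩, hγ⟩, rfl⟩

/-- The exponents of the minimal monomial generators of `V` of degree `c + b + t`, `c = a - b`. -/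
noncomputable def generatorLevel (A B C : Finset (Fin n)) (c b t : ℕ) : Finset (Fin n →₀ ℕ) :=
  B.finsuppAntidiag t + A.finsuppAntidiag (c + t) + C.finsuppAntidiag (b - t)

theorem idealV_eq_monomialIdeal (k : Type*) [Field k] (J K : Finset (Fin n)) (a b : ℕ) :
    idealV k J K a b = monomialIdeal k
      ((Finset.Icc 1 b).biUnion (generatorLevel (J \ K) (K \ J) (J ∩ K) (a - b) b)) := by
  rw [← sum_monomialIdeal, idealV]
  refine Finset.sum_congr rfl fun t _ => ?_
  rw [varIdeal_pow, varIdeal_pow, varIdeal_pow, monomialIdeal_mul, monomialIdeal_mul,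
    generatorLevel]

/-- The variables generating the colon ideal of the generator `u` of `V` by its predecessors. -/
def colonVars (A B C : Finset (Fin n)) (u : Fin n →₀ ℕ) : Finset (Fin n) :=
  laterVars A u ∪ laterVars B u ∪ if ∑ x ∈ B, u x = 1 then laterVars C u else C

theorem laterVars_subset (T : Finset (Fin n)) (u : Fin n →₀ ℕ) : laterVars T u ⊆ T :=
  Finset.filter_subset _ _

/-- The order on monomials: by degree, then lexicographically. -/
noncomputable def degLexKey (u : Fin n →₀ ℕ) : ℕ ×ₗ Lex (Fin n →₀ ℕ) := toLex (u.degree, toLex u)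

theorem degLexKey_lt_iff {u v : Fin n →₀ ℕ} : degLexKey v < degLexKey u ↔
    v.degree < u.degree ∨ v.degree = u.degree ∧ ∃ i, (∀ x < i, v x = u x) ∧ v i < u i := by
  rw [degLexKey, degLexKey, Prod.Lex.toLex_lt_toLex]
  rfl

theorem degLexKey_injective : Function.Injective (degLexKey (n := n)) := by
  intro u v h
  have h1 := congrArg Prod.snd (toLex.injective h)
  exact toLex.injective h1

theorem sum_single_one (T : Finset (Fin n)) (i : Fin n) :
    ∑ x ∈ T, (Finsupp.single i 1 : Fin n →₀ ℕ) x = if i ∈ T then 1 else 0 := by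
  simp [Finsupp.single_apply]

section Generators

variable {A B C : Finset (Fin n)} (hAB : Disjoint A B) (hAC : Disjoint A C) (hBC : Disjoint B C)
  {c b : ℕ}

include hAB hAC hBC

theorem mem_generatorLevel {t : ℕ} {u : Fin n →₀ ℕ} : u ∈ generatorLevel A B C c b t ↔
    (∀ x, u x ≠ 0 → x ∈ A ∨ x ∈ B ∨ x ∈ C) ∧
      ∑ x ∈ A, u x = c + t ∧ ∑ x ∈ B, u x = t ∧ ∑ x ∈ C, u x = b - t :=
  mem_add_add_finsuppAntidiag hAB hAC hBC

theorem degree_of_mem_generatorLevel {t : ℕ} (ht : t ≤ b) {u : Fin n →₀ ℕ}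
    (hu : u ∈ generatorLevel A B C c b t) : u.degree = c + b + t := by
  obtain ⟨h1, h2, h3, h4⟩ := (mem_generatorLevel hAB hAC hBC).1 hu
  have h5 : u.degree = ∑ x ∈ A ∪ B ∪ C, u x := by
    rw [Finsupp.degree_apply]
    refine Finset.sum_subset (fun x hx => ?_) fun x _ hx => Finsupp.notMem_support_iff.1 hx
    have := h1 x (Finsupp.mem_support_iff.1 hx)
    simp only [Finset.mem_union, or_assoc]
    exact this
  rw [h5, Finset.sum_union (Finset.disjoint_union_left.2 ⟨hAC, hBC⟩), Finset.sum_union hAB]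
  omega

/-- Replace an earlier variable `i` of the same block by `l`: block degrees are kept, and the
exponent drops at `i`, the first place of change, so the new monomial precedes `u`. -/
theorem exists_exchange {t : ℕ} (htb : t ≤ b) {u : Fin n →₀ ℕ}
    (hu : u ∈ generatorLevel A B C c b t) {l : Fin n} {T : Finset (Fin n)}
    (hT : T = A ∨ T = B ∨ T = C) (hlT : l ∈ laterVars T u) :
    ∃ v, v ∈ generatorLevel A B C c b t ∧ degLexKey v < degLexKey u ∧
      v ≤ u + Finsupp.single l 1 := by
  have hdu := degree_of_mem_generatorLevel hAB hAC hBC htb hu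
  obtain ⟨h1, h2, h3, h4⟩ := (mem_generatorLevel hAB hAC hBC).1 hu
  obtain ⟨hlT, i, hiT, hil, hui⟩ := Finset.mem_filter.1 hlT
  have hle : Finsupp.single i 1 ≤ u + Finsupp.single l 1 := by
    rw [Finsupp.single_le_iff, Finsupp.add_apply]
    omega
  have hv := tsub_add_cancel_of_le hle
  have hmem : ∀ S : Finset (Fin n), S = A ∨ S = B ∨ S = C → (l ∈ S ↔ i ∈ S) := by
    intro S hS
    by_cases hST : S = T
    · subst hST
      exact ⟨fun _ => hiT, fun _ => hlT⟩
    · have : Disjoint S T := by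
        rcases hT with rfl | rfl | rfl <;> rcases hS with rfl | rfl | rfl <;>
          first
            | exact absurd rfl hST
            | assumption
            | exact Disjoint.symm (by assumption)
      exact ⟨fun h => absurd hlT (Finset.disjoint_left.1 this h),
        fun h => absurd hiT (Finset.disjoint_left.1 this h)⟩
  set v := u + Finsupp.single l 1 - Finsupp.single i 1
  have hvx : ∀ x, v x + (Finsupp.single i 1 : Fin n →₀ ℕ) x =
      u x + (Finsupp.single l 1 : Fin n →₀ ℕ) x := fun x => DFunLike.congr_fun hv x
  have hsum : ∀ S : Finset (Fin n), S = A ∨ S = B ∨ S = C → ∑ x ∈ S, v x = ∑ x ∈ S, u x := by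
    intro S hS
    have h5 : ∑ x ∈ S, (v x + (Finsupp.single i 1 : Fin n →₀ ℕ) x) =
      ∑ x ∈ S, (u x + (Finsupp.single l 1 : Fin n →₀ ℕ) x) :=
        Finset.sum_congr rfl fun x _ => hvx x
    rw [Finset.sum_add_distrib, Finset.sum_add_distrib, sum_single_one, sum_single_one] at h5
    simp only [hmem S hS] at h5
    omega
  have hvmem : v ∈ generatorLevel A B C c b t := by
    rw [mem_generatorLevel hAB hAC hBC, hsum A (Or.inl rfl),
      hsum B (Or.inr (Or.inl rfl)), hsum C (Or.inr (Or.inr rfl))]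
    refine ⟨fun x hx => ?_, h2, h3, h4⟩
    by_cases hxl : x = l
    · subst hxl
      rcases hT with rfl | rfl | rfl
      · exact Or.inl hlT
      · exact Or.inr (Or.inl hlT)
      · exact Or.inr (Or.inr hlT)
    · refine h1 x fun h => ?_
      have := hvx x
      rw [Finsupp.single_eq_of_ne (a := l) hxl] at this
      omega
  refine ⟨v, hvmem, ?_, tsub_le_self⟩
  rw [degLexKey_lt_iff]
  refine Or.inr ⟨by rw [hdu, degree_of_mem_generatorLevel hAB hAC hBC htb hvmem], i,
    fun x hx => ?_, ?_⟩
  · have := hvx x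
    rw [Finsupp.single_eq_of_ne hx.ne, Finsupp.single_eq_of_ne (hx.trans hil).ne] at this
    omega
  · have := hvx i
    rw [Finsupp.single_eq_same, Finsupp.single_eq_of_ne hil.ne] at this
    omega

theorem exists_of_mem_colonVars {t : ℕ} (ht1 : 1 ≤ t) (htb : t ≤ b) {u : Fin n →₀ ℕ}
    (hu : u ∈ generatorLevel A B C c b t) {l : Fin n} (hl : l ∈ colonVars A B C u) :
    ∃ t' v, 1 ≤ t' ∧ t' ≤ b ∧ v ∈ generatorLevel A B C c b t' ∧ degLexKey v < degLexKey u ∧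
      v ≤ u + Finsupp.single l 1 := by
  have hdu := degree_of_mem_generatorLevel hAB hAC hBC htb hu
  obtain ⟨h1, h2, h3, h4⟩ := (mem_generatorLevel hAB hAC hBC).1 hu
  have hl' : l ∈ laterVars A u ∨ l ∈ laterVars B u ∨ (l ∈ laterVars C u) ∨ (t ≠ 1 ∧ l ∈ C) := by
    rw [colonVars, h3] at hl
    rcases Finset.mem_union.1 hl with hl | hl
    · exact (Finset.mem_union.1 hl).imp_right Or.inl
    · split_ifs at hl with h
      · exact Or.inr (Or.inr (Or.inl hl))
      · exact Or.inr (Or.inr (Or.inr ⟨h, hl⟩))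
  rcases hl' with hl | hl | hl | ⟨ht, hl⟩
  · obtain ⟨v, hv⟩ := exists_exchange hAB hAC hBC htb hu (Or.inl rfl) hl
    exact ⟨t, v, ht1, htb, hv⟩
  · obtain ⟨v, hv⟩ := exists_exchange hAB hAC hBC htb hu (Or.inr (Or.inl rfl)) hl
    exact ⟨t, v, ht1, htb, hv⟩
  · obtain ⟨v, hv⟩ := exists_exchange hAB hAC hBC htb hu (Or.inr (Or.inr rfl)) hl
    exact ⟨t, v, ht1, htb, hv⟩
  -- Here t ≥ 2 and `l` is in C. Trading one variable of A and one of B for `l` gives a generator of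
  -- level `t - 1 ≥ 1`, of degree one less.
  · obtain ⟨i, hi, hui⟩ := Finset.exists_ne_zero_of_sum_ne_zero (s := A) (f := u) (by omega)
    obtain ⟨i', hi', hui'⟩ := Finset.exists_ne_zero_of_sum_ne_zero (s := B) (f := u) (by omega)
    have hii : i ≠ i' := fun h => Finset.disjoint_left.1 hAB hi (h ▸ hi')
    have hle : Finsupp.single i 1 + Finsupp.single i' 1 ≤ u + Finsupp.single l 1 := by
      intro x
      simp only [Finsupp.add_apply, Finsupp.single_apply]
      split_ifs with hx hx' <;> subst_vars <;> omega
    have hv := tsub_add_cancel_of_le hle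
    set v := u + Finsupp.single l 1 - (Finsupp.single i 1 + Finsupp.single i' 1)
    have hvx : ∀ x, v x + ((Finsupp.single i 1 : Fin n →₀ ℕ) x +
        (Finsupp.single i' 1 : Fin n →₀ ℕ) x) =
        u x + (Finsupp.single l 1 : Fin n →₀ ℕ) x := fun x => DFunLike.congr_fun hv x
    have hsum : ∀ S : Finset (Fin n), ∑ x ∈ S, v x +
        ((if i ∈ S then 1 else 0) + if i' ∈ S then 1 else 0) =
        ∑ x ∈ S, u x + if l ∈ S then 1 else 0 := by
      intro S
      rw [← sum_single_one, ← sum_single_one, ← sum_single_one, ← Finset.sum_add_distrib, ← Finset.sum_add_distrib,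
        ← Finset.sum_add_distrib]
      exact Finset.sum_congr rfl fun x _ => hvx x
    have hvmem : v ∈ generatorLevel A B C c b (t - 1) := by
      rw [mem_generatorLevel hAB hAC hBC]
      have hA := hsum A
      have hB := hsum B
      have hC := hsum C
      simp only [hi, hi', hl, Finset.disjoint_right.1 hAB hi', Finset.disjoint_left.1 hAB hi,
        Finset.disjoint_right.1 hAC hl, Finset.disjoint_right.1 hBC hl,
        Finset.disjoint_left.1 hAC hi, Finset.disjoint_left.1 hBC hi', if_true, if_false]
        at hA hB hC
      have hC' : ∑ x ∈ C, u x + 1 ≤ b := by omega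
      refine ⟨fun x hx => ?_, by omega, by omega, by omega⟩
      by_cases hxl : x = l
      · subst hxl
        exact Or.inr (Or.inr hl)
      · refine h1 x fun h => ?_
        have := hvx x
        rw [Finsupp.single_eq_of_ne (a := l) hxl] at this
        omega
    refine ⟨t - 1, v, by omega, by omega, hvmem, ?_, tsub_le_self⟩
    rw [degLexKey_lt_iff, hdu, degree_of_mem_generatorLevel hAB hAC hBC (by omega) hvmem]
    exact Or.inl (by omega)

theorem exists_mem_colonVars_lt {t t' : ℕ} (ht'1 : 1 ≤ t') (htb : t ≤ b)
    (ht'b : t' ≤ b) {u v : Fin n →₀ ℕ} (hu : u ∈ generatorLevel A B C c b t)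
    (hv : v ∈ generatorLevel A B C c b t') (hvu : degLexKey v < degLexKey u) :
    ∃ l ∈ colonVars A B C u, u l < v l := by
  rw [degLexKey_lt_iff, degree_of_mem_generatorLevel hAB hAC hBC htb hu,
    degree_of_mem_generatorLevel hAB hAC hBC ht'b hv] at hvu
  obtain ⟨h1, h2, h3, h4⟩ := (mem_generatorLevel hAB hAC hBC).1 hu
  obtain ⟨-, h2', h3', h4'⟩ := (mem_generatorLevel hAB hAC hBC).1 hv
  have hlt : ∀ T : Finset (Fin n), ∑ x ∈ T, v x = ∑ x ∈ T, u x → ∀ i ∈ T, v i < u i →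
      (∀ x < i, v x = u x) → ∃ l ∈ laterVars T u, u l < v l := by
    intro T hT i hiT hi hix
    have h5 : ∃ l ∈ T, u l < v l := by
      by_contra! hc
      exact (Finset.sum_lt_sum hc ⟨i, hiT, hi⟩).ne hT
    obtain ⟨l, hlT, hl⟩ := h5
    -- The exponents agree before `i` and `v` is smaller at `i`, so the place where `v` exceeds `u`
    -- comes after `i`.
    refine ⟨l, Finset.mem_filter.2 ⟨hlT, i, hiT, ?_, by omega⟩, hl⟩
    rcases lt_trichotomy l i with h | rfl | h
    · rw [hix l h] at hl
      exact absurd hl (lt_irrefl _)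
    · omega
    · exact h
  rcases hvu with htt | ⟨htt, i, hix, hi⟩
  -- For t' < t the C-degree `b - t'` of `v` exceeds that of `u`; moreover t ≥ 2, so all of C is
  -- available.
  · obtain ⟨l, hl, hlt⟩ := Finset.exists_lt_of_sum_lt (s := C) (f := u) (g := v) (by omega)
    refine ⟨l, ?_, hlt⟩
    rw [colonVars, if_neg (by omega)]
    exact Finset.mem_union_right _ hl
  · obtain rfl : t' = t := by omega
    rcases h1 i (by omega) with hiT | hiT | hiT
    · obtain ⟨l, hl, hul⟩ := hlt A (by omega) i hiT hi hix
      exact ⟨l, Finset.mem_union_left _ (Finset.mem_union_left _ hl), hul⟩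
    · obtain ⟨l, hl, hul⟩ := hlt B (by omega) i hiT hi hix
      exact ⟨l, Finset.mem_union_left _ (Finset.mem_union_right _ hl), hul⟩
    · obtain ⟨l, hl, hul⟩ := hlt C (by omega) i hiT hi hix
      refine ⟨l, Finset.mem_union_right _ ?_, hul⟩
      split_ifs
      · exact hl
      · exact laterVars_subset _ _ hl

theorem hasMinimalResolution_monomialIdeal (k : Type*) [Field k] :
    HasMinimalResolution
      (monomialIdeal k ((Finset.Icc 1 b).biUnion (generatorLevel A B C c b)))
      fun i j => ∑ u ∈ (Finset.Icc 1 b).biUnion (generatorLevel A B C c b),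
        if j = u.degree + i then (colonVars A B C u).card.choose i else 0 := by
  refine hasMinimalResolution_of_linearQuotients degLexKey degLexKey_injective
    (fun u v h => ?_) (colonVars A B C) _ (fun u hu l hl => ?_) fun u hu v hv huv => ?_
  · rcases degLexKey_lt_iff.1 h with h | h
    · exact h.le
    · exact h.1.le
  · obtain ⟨t, ht, hu⟩ := Finset.mem_biUnion.1 hu
    rw [Finset.mem_Icc] at ht
    obtain ⟨t', v, ht1, htb, hv, hlt, hle⟩ :=
      exists_of_mem_colonVars hAB hAC hBC ht.1 ht.2 hu hl
    exact ⟨v, Finset.mem_biUnion.2 ⟨t', Finset.mem_Icc.2 ⟨ht1, htb⟩, hv⟩, hlt, hle⟩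
  · obtain ⟨t, ht, hu⟩ := Finset.mem_biUnion.1 hu
    obtain ⟨t', ht', hv⟩ := Finset.mem_biUnion.1 hv
    rw [Finset.mem_Icc] at ht ht'
    exact exists_mem_colonVars_lt hAB hAC hBC ht'.1 ht.2 ht'.2 hu hv huv

/-- Different levels have different degrees, so the internal degree selects a single level. -/
theorem sum_generators_eq_sum_level {j : ℕ} (hj1 : 1 ≤ j) (hjb : j ≤ b) (i : ℕ) :
    (∑ u ∈ (Finset.Icc 1 b).biUnion (generatorLevel A B C c b),
      if c + b + j + i = u.degree + i then (colonVars A B C u).card.choose i else 0) =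
      ∑ u ∈ generatorLevel A B C c b j, (colonVars A B C u).card.choose i := by
  rw [← Finset.sum_filter]
  refine Finset.sum_congr ?_ fun _ _ => rfl
  ext u
  rw [Finset.mem_filter, Finset.mem_biUnion]
  constructor
  · rintro ⟨⟨t, ht, hu⟩, hd⟩
    rw [degree_of_mem_generatorLevel hAB hAC hBC (Finset.mem_Icc.1 ht).2 hu] at hd
    obtain rfl : t = j := by omega
    exact hu
  · exact fun hu => ⟨⟨j, Finset.mem_Icc.2 ⟨hj1, hjb⟩, hu⟩, by
      rw [degree_of_mem_generatorLevel hAB hAC hBC hjb hu]⟩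

theorem sum_level_colonVars (j i : ℕ) :
    ∑ u ∈ generatorLevel A B C c b j, (colonVars A B C u).card.choose i =
      ∑ α ∈ A.finsuppAntidiag (c + j), ∑ β ∈ B.finsuppAntidiag j,
        ∑ γ ∈ C.finsuppAntidiag (b - j), ((laterVars A α).card + (laterVars B β).card +
          if j = 1 then (laterVars C γ).card else C.card).choose i := by
  rw [generatorLevel, sum_add_add_finsuppAntidiag hAB hAC hBC]
  refine Finset.sum_congr rfl fun α hα => Finset.sum_congr rfl fun β hβ =>
    Finset.sum_congr rfl fun γ hγ => ?_
  rw [mem_finsuppAntidiag_iff] at hα hβ hγ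
  have eA : laterVars A (β + α + γ) = laterVars A α := laterVars_congr fun x hx => by
    rw [Finsupp.add_apply, Finsupp.add_apply, apply_eq_zero_of_disjoint hAB hβ.2 hx,
      apply_eq_zero_of_disjoint hAC hγ.2 hx, zero_add, add_zero]
  have hB : ∀ x ∈ B, (β + α + γ) x = β x := fun x hx => by
    rw [Finsupp.add_apply, Finsupp.add_apply, apply_eq_zero_of_disjoint hAB.symm hα.2 hx,
      apply_eq_zero_of_disjoint hBC hγ.2 hx, add_zero, add_zero]
  have eC : laterVars C (β + α + γ) = laterVars C γ := laterVars_congr fun x hx => by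
    rw [Finsupp.add_apply, Finsupp.add_apply, apply_eq_zero_of_disjoint hAC.symm hα.2 hx,
      apply_eq_zero_of_disjoint hBC.symm hβ.2 hx, zero_add, zero_add]
  rw [colonVars, eA, laterVars_congr hB, eC, Finset.sum_congr rfl hB, hβ.1]
  have hsub : (if j = 1 then laterVars C γ else C) ⊆ C := by
    split_ifs
    · exact laterVars_subset _ _
    · exact subset_rfl
  rw [Finset.card_union_of_disjoint, Finset.card_union_of_disjoint, apply_ite Finset.card]
  · exact hAB.mono (laterVars_subset _ _) (laterVars_subset _ _)
  · exact (Finset.disjoint_union_left.2 ⟨hAC, hBC⟩).mono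
      (Finset.union_subset_union (laterVars_subset _ _) (laterVars_subset _ _)) hsub

end Generators

theorem sum_mul_mul_sum {ι₁ ι₂ ι₃ τ : Type*} (S₁ : Finset ι₁) (S₂ : Finset ι₂) (S₃ : Finset ι₃)
    (T : Finset τ) (f : ι₁ → τ → ℕ) (g : ι₂ → τ → ℕ) (h : ι₃ → τ → ℕ) :
    ∑ t ∈ T, (∑ β ∈ S₂, g β t) * (∑ α ∈ S₁, f α t) * (∑ γ ∈ S₃, h γ t) =
      ∑ α ∈ S₁, ∑ β ∈ S₂, ∑ γ ∈ S₃, ∑ t ∈ T, g β t * f α t * h γ t := by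
  have e : ∀ α, ∑ β ∈ S₂, ∑ γ ∈ S₃, ∑ t ∈ T, g β t * f α t * h γ t =
      ∑ t ∈ T, ∑ β ∈ S₂, ∑ γ ∈ S₃, g β t * f α t * h γ t := fun α =>
    (Finset.sum_congr rfl fun β _ => Finset.sum_comm).trans Finset.sum_comm
  rw [Finset.sum_congr rfl fun α _ => e α, Finset.sum_comm]
  refine Finset.sum_congr rfl fun t _ => ?_
  rw [mul_comm (∑ β ∈ S₂, g β t), Finset.sum_mul_sum, Finset.sum_mul]
  refine Finset.sum_congr rfl fun α _ => ?_
  rw [Finset.sum_mul]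
  refine Finset.sum_congr rfl fun β _ => ?_
  rw [Finset.mul_sum]
  exact Finset.sum_congr rfl fun γ _ => by ring

end IdealV

/-! ### Evaluation of the two formulas -/

theorem theorem5p6 (k : Type*) [Field k] (n : ℕ) (J K A B C : Finset (Fin n)) (a b : ℕ)
    (hb : 1 ≤ b) (hab : b ≤ a)
    (hA : A = J \ K) (hB : B = K \ J) (hC : C = J ∩ K)
    (hAne : A.Nonempty) (hBne : B.Nonempty) (hCne : C.Nonempty) :
    (∀ i : ℕ, HasGradedBetti (idealV k J K a b) i (i + a + 1)
      (∑ t ∈ Finset.Nat.antidiagonalTuple 3 i,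
        B.card.choose (1 + t 0) *
          ((A.card + a - b).choose (a - b + 1 + t 1) * (a - b + t 1).choose (t 1)) *
          ((C.card + b - 2).choose (b - 1 + t 2) * (b + t 2 - 2).choose (t 2)))) ∧
    (∀ i j : ℕ, 2 ≤ j → j ≤ b → HasGradedBetti (idealV k J K a b) i (i + a + j)
      (∑ k₁ ∈ Finset.range A.card, ∑ k₂ ∈ Finset.range B.card,
        (C.card + b - j - 1).choose (b - j) *
          (k₁ + a - b + j - 1).choose (a - b + j - 1) *
          (k₂ + j - 1).choose (j - 1) *
          (C.card + k₁ + k₂).choose i)) := by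
  have hAB : Disjoint A B := by
    subst hA hB
    exact Finset.disjoint_left.2 fun x h1 h2 =>
      (Finset.mem_sdiff.1 h1).2 (Finset.mem_sdiff.1 h2).1
  have hAC : Disjoint A C := by
    subst hA hC
    exact Finset.disjoint_left.2 fun x h1 h2 =>
      (Finset.mem_sdiff.1 h1).2 (Finset.mem_inter.1 h2).2
  have hBC : Disjoint B C := by
    subst hB hC
    exact Finset.disjoint_left.2 fun x h1 h2 =>
      (Finset.mem_sdiff.1 h1).2 (Finset.mem_inter.1 h2).1
  have hC1 := hCne.card_pos
  have key : ∀ i j, 1 ≤ j → j ≤ b → HasGradedBetti (idealV k J K a b) i (i + a + j)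
      (∑ α ∈ A.finsuppAntidiag (a - b + j), ∑ β ∈ B.finsuppAntidiag j,
        ∑ γ ∈ C.finsuppAntidiag (b - j), ((laterVars A α).card + (laterVars B β).card +
          if j = 1 then (laterVars C γ).card else C.card).choose i) := by
    intro i j h1 h2
    rw [← sum_level_colonVars hAB hAC hBC, ← sum_generators_eq_sum_level hAB hAC hBC h1 h2,
      show a - b + b + j + i = i + a + j by omega, idealV_eq_monomialIdeal, ← hA, ← hB, ← hC]
    exact (hasMinimalResolution_monomialIdeal hAB hAC hBC k).hasGradedBetti i (i + a + j)
  refine ⟨fun i => ?_, fun i j h1 h2 => ?_⟩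
  · convert key i 1 le_rfl hb using 1
    have hCsum : ∀ m, ∑ γ ∈ C.finsuppAntidiag (b - 1), (laterVars C γ).card.choose m =
        (C.card + b - 2).choose (b - 1 + m) * (b + m - 2).choose m := by
      intro m
      obtain ⟨e, rfl⟩ : ∃ e, b = e + 1 := ⟨b - 1, by omega⟩
      -- For b = 1 only the monomial 1 remains in C, with no later variables. Truncated subtraction
      -- turns `b + m - 2` into 0 at m = 0, which realises the convention binom(-1, 0) = 1.
      rcases e with _ | e
      · have h0 : laterVars C 0 = ∅ := by simp [laterVars]
        rcases m with _ | m
        · simp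
        · simp [h0, show 0 + 1 + (m + 1) - 2 = m by omega]
      · rw [show e + 1 + 1 - 1 = e + 1 by omega, sum_choose_laterVars,
          show C.card + (e + 1 + 1) - 2 = C.card + e by omega,
          show e + 1 + 1 + m - 2 = e + m by omega]
    simp only [if_true]
    have hAsum : ∀ m, (A.card + a - b).choose (a - b + 1 + m) * (a - b + m).choose m =
        ∑ α ∈ A.finsuppAntidiag (a - b + 1), (laterVars A α).card.choose m := fun m => by
      rw [sum_choose_laterVars, show A.card + a - b = A.card + (a - b) by omega]
    have hBsum : ∀ m, B.card.choose (1 + m) =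
        ∑ β ∈ B.finsuppAntidiag 1, (laterVars B β).card.choose m := fun m => by
      simpa using (sum_choose_laterVars B 0 m).symm
    simp only [hAsum, hBsum, ← hCsum]
    rw [sum_mul_mul_sum]
    refine Finset.sum_congr rfl fun α _ => Finset.sum_congr rfl fun β _ =>
      Finset.sum_congr rfl fun γ _ => ?_
    rw [add_comm (laterVars A α).card, add_add_choose_eq_sum_antidiagonalTuple]
  · convert key i j (by omega) h2 using 1
    simp only [show j ≠ 1 by omega, if_false]
    obtain ⟨e, rfl⟩ : ∃ e, j = e + 1 := ⟨j - 1, by omega⟩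
    have hcard : (C.finsuppAntidiag (b - (e + 1))).card =
        (C.card + b - (e + 1) - 1).choose (b - (e + 1)) := by
      rw [Finset.card_finsuppAntidiag_nat_eq_choose,
        show C.card + (b - (e + 1)) - 1 = C.card + b - (e + 1) - 1 by omega]
    simp only [Finset.sum_const, hcard, smul_eq_mul]
    -- The summand depends on α and β only through their numbers of later variables, so
    -- `sum_laterVars` applies to A and then to B; these numbers become k₁ and k₂.
    rw [← add_assoc (a - b),
      sum_laterVars A (a - b + e) fun m => ∑ β ∈ B.finsuppAntidiag (e + 1),
        (C.card + b - (e + 1) - 1).choose (b - (e + 1)) *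
          (m + (laterVars B β).card + C.card).choose i]
    refine Finset.sum_congr rfl fun m₁ _ => ?_
    rw [sum_laterVars B e fun m => (C.card + b - (e + 1) - 1).choose (b - (e + 1)) *
          (m₁ + m + C.card).choose i, Finset.mul_sum]
    refine Finset.sum_congr rfl fun m₂ _ => ?_
    rw [show m₁ + a - b + (e + 1) - 1 = m₁ + (a - b + e) by omega,
      Nat.add_sub_cancel, show m₂ + (e + 1) - 1 = m₂ + e by omega,
      Nat.add_sub_cancel, show C.card + m₁ + m₂ = m₁ + m₂ + C.card by omega]
    ring
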